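/- Let $\Omega\subset\mathbb C^n$ be a domain (a non-empty connected open set), let $w\in\Omega$, and let $\lambda$ be Lebesgue measure on $\mathbb C^n=\mathbb R^{2n}$. Let $$K_\Omega(w)=\sup\Big\{|f(w)|^2:\ f\ \text{holomorphic on}\ \Omega,\ \int_\Omega|f|^2\,d\lambda\le 1\Big\}$$ be the Bergman kernel on the diagonal, let $$G_{\Omega,w}(z)=\sup\big\{u(z):\ u\le 0\ \text{plurisubharmonic on}\ \Omega,\ u\le\log|\cdot-w|+C_u\ \text{near}\ w\ \text{for some}\ C_u\in\mathbb R\big\}$$ be the pluricomplex Green function (the function $u\equiv-\infty$ being admitted), and let $$I^A_\Omega(w)=\Big\{X\in\mathbb C^n:\ \limsup_{\zeta\to0,\ \zeta\in\mathbb C\setminus\{0\}}\big(G_{\Omega,w}(w+\zeta X)-\log|\zeta|\big)<0\Big\}$$ be the Azukawa indicatrix. Call $\Omega$ $\mathbb C$-convex if its intersection with every complex affine line is empty or is connected and simply connected. Then $$K_\Omega(w)\le\frac{C^n}{\lambda(I^A_\Omega(w))}\qquad(\text{the right-hand side being }0\text{ if }\lambda(I^A_\Omega(w))=\infty)$$ holds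 1. with $C=16$ if $\Omega$ is $\mathbb C$-convex; 2. with $C=4$ if $\Omega$ is convex; 3. with $C=16/\pi^2$ if $\Omega$ is convex and symmetric with respect to $w$, that is, $w+v\in\Omega$ implies $w-v\in\Omega$. -/

import Mathlib

open Set Filter Topology MeasureTheory
open scoped ENNReal

noncomputable section

/-- The Bergman kernel on the diagonal,
`K_Ω(w) = sup {|f(w)|² : f holomorphic on Ω, ∫_Ω |f|² dλ ≤ 1}`, as an element of `[0, ∞]`. -/
def bergmanKernel {n : ℕ} (Ω : Set (EuclideanSpace ℂ (Fin n))) (w : EuclideanSpace ℂ (Fin n)) :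
    ℝ≥0∞ :=
  ⨆ (f : EuclideanSpace ℂ (Fin n) → ℂ) (_ : DifferentiableOn ℂ f Ω)
    (_ : ∫⁻ z in Ω, ‖f z‖ₑ ^ 2 ≤ 1), ‖f w‖ₑ ^ 2

/-- The mean value `(1 / 2π) ∫₀^{2π} g(θ) dθ` of an extended real function, as the mean value of
the positive part minus the mean value of the negative part. (It is used for functions that are
bounded above, so the first term is finite.) -/
def angularMean (g : ℝ → EReal) : EReal :=
  ((⨍⁻ θ in Ioc 0 (2 * Real.pi), (g θ).toENNReal ∂volume : ℝ≥0∞) : EReal) -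
    ((⨍⁻ θ in Ioc 0 (2 * Real.pi), (-g θ).toENNReal ∂volume : ℝ≥0∞) : EReal)

/-- `u : Ω → [-∞, ∞)` is plurisubharmonic on the open set `Ω`: it is upper semicontinuous, and it
satisfies the sub-mean value inequality on every closed complex disc
`{a + ζ X : |ζ| ≤ 1}` contained in `Ω`. The function that is identically `-∞` is allowed.
The values of `u` outside `Ω` play no role. -/
structure IsPlurisubharmonicOn {n : ℕ} (u : EuclideanSpace ℂ (Fin n) → EReal)
    (Ω : Set (EuclideanSpace ℂ (Fin n))) : Prop where
  lt_top : ∀ z ∈ Ω, u z < ⊤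
  upperSemicontinuousOn : UpperSemicontinuousOn u Ω
  le_mean : ∀ a X : EuclideanSpace ℂ (Fin n), (∀ ζ : ℂ, ‖ζ‖ ≤ 1 → a + ζ • X ∈ Ω) →
    u a ≤ angularMean (fun θ => u (a + circleMap 0 1 θ • X))

/-- The competitors for the pluricomplex Green function of `Ω` with pole at `w`: the nonpositive
plurisubharmonic functions `u` on `Ω` with `u ≤ log |· - w| + C` near `w`, for some real `C`.
Here `log 0 = -∞`. -/
def greenFamily {n : ℕ} (Ω : Set (EuclideanSpace ℂ (Fin n))) (w : EuclideanSpace ℂ (Fin n)) :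
    Set (EuclideanSpace ℂ (Fin n) → EReal) :=
  {u | IsPlurisubharmonicOn u Ω ∧ (∀ z ∈ Ω, u z ≤ 0) ∧
    ∃ C : ℝ, ∀ᶠ z in 𝓝 w, u z ≤ ENNReal.log ‖z - w‖ₑ + (C : EReal)}

/-- The pluricomplex Green function `G_{Ω,w}`, with values in `[-∞, 0]` on `Ω`. -/
def pluricomplexGreen {n : ℕ} (Ω : Set (EuclideanSpace ℂ (Fin n)))
    (w z : EuclideanSpace ℂ (Fin n)) : EReal :=
  ⨆ u ∈ greenFamily Ω w, u z

/-- The Azukawa indicatrix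
`I^A_Ω(w) = {X : limsup_{ζ → 0} (G_{Ω,w}(w + ζ X) - log |ζ|) < 0}`. -/
def azukawaIndicatrix {n : ℕ} (Ω : Set (EuclideanSpace ℂ (Fin n)))
    (w : EuclideanSpace ℂ (Fin n)) : Set (EuclideanSpace ℂ (Fin n)) :=
  {X | limsup (fun ζ : ℂ => pluricomplexGreen Ω w (w + ζ • X) - (Real.log ‖ζ‖ : EReal))
    (𝓝[≠] (0 : ℂ)) < 0}

/-- `Ω` is `ℂ`-convex: its intersection with every complex affine line
`{a + ζ v : ζ ∈ ℂ}`, `v ≠ 0`, is empty or connected and simply connected. The intersection is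
read in the coordinate `ζ` of the line. (`IsSimplyConnected` includes path connectedness.) -/
def IsCConvex {n : ℕ} (Ω : Set (EuclideanSpace ℂ (Fin n))) : Prop :=
  ∀ a v : EuclideanSpace ℂ (Fin n), v ≠ 0 → {ζ : ℂ | a + ζ • v ∈ Ω}.Nonempty →
    IsSimplyConnected {ζ : ℂ | a + ζ • v ∈ Ω}

end

/-! Let `B` be the balanced part of `Ω - w`, the set of `X` whose closed disc `w + ηX`, `|η| ≤ 1`,
lies in `Ω`. Averaging the mean value inequality for `|f|²` over these discs gives `K_Ω(w) λ(B) ≤ 1`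
(`bergmanKernel_mul_volume_le`). Since real dimension is `2n`, it suffices to show that the Azukawa
indicatrix lies in `cB` with `c = 4`, `2` or `4/π`; this yields the constant `c²` in each case
(`bergmanKernel_le_of_subset`).

If `X ∉ cB`, some point `w + (η/c)X` with `|η| ≤ 1` is outside `Ω`. A complex linear form `ξ`
separates it from `Ω`: `ξ(· - w)` maps `Ω` into a planar domain `D`, while `|ξ(X)| ≥ c`. If `D` maps
holomorphically to the disc with `ψ(0) = 0` and `|ψ'(0)|` at least (or arbitrarily close to) `1/c`,
then `log |ψ(ξ(· - w))|` competes for the Green function and forces the limsup at `X` to be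
nonnegative (`notMem_azukawaIndicatrix_of_clm`).

For convex `Ω`, Hahn-Banach gives a half-plane, with `|ψ'(0)| = 1/2`; with symmetry it gives a
strip, with `|ψ'(0)| = π/4`. For `ℂ`-convex `Ω` two more ingredients are needed. The first is a
complex hyperplane through the omitted point that misses `Ω`, such that the projection `D` along it
carries continuous logarithms (`IsWeaklyCConvex.exists_hyperplane`); the obstruction to finding it
is the absence of a logarithm on the punctured plane. The second is Koebe's one-quarter theorem for
`D` (`exists_mapsTo_ball_deriv_ge`), which follows from an approximate Riemann mapping theorem and
Gelfer's inequality for a square root of `1 - F`, with `F` the inverse of the map. Gelfer's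
inequality comes from the Cauchy determinant. -/

/-! ### Cauchy determinants and Gelfer's inequality. -/

/-- The Cauchy determinant. -/
theorem det_cauchy {K : Type*} [Field K] : ∀ (n : ℕ) (a b : Fin n → K), (∀ i j, a i + b j ≠ 0) →
    (Matrix.of fun i j => (a i + b j)⁻¹).det * ∏ i, ∏ j, (a i + b j) =
      ∏ i, ∏ j ∈ Finset.Ioi i, ((a i - a j) * (b i - b j))
  | 0, _, _, _ => by simp
  | n + 1, a, b, h => by
    have ih := det_cauchy n (fun i => a i.succ) (fun i => b i.succ) (fun i j => h _ _)
    set A' : Matrix (Fin n) (Fin n) K := Matrix.of fun i j => (a i.succ + b j.succ)⁻¹ with hA'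
    set u : Fin n → K := fun i => (a i.succ - a 0) / (a i.succ + b 0) with hu
    set v : Fin n → K := fun j => (b j.succ - b 0) / (a 0 + b j.succ) with hv
    -- Row reduction by row `0` clears column `0` below the corner; the remaining minor is the
    -- smaller Cauchy matrix `A'` with rows scaled by `u` and columns by `v`.
    set B : Matrix (Fin (n + 1)) (Fin (n + 1)) K := Matrix.of fun i j =>
      (a i + b j)⁻¹ - (if i = 0 then 0 else (a 0 + b 0) / (a i + b 0)) * (a 0 + b j)⁻¹ with hB
    have h1 : (Matrix.of fun i j => (a i + b j)⁻¹).det = B.det := by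
      refine Matrix.det_eq_of_forall_row_eq_smul_add_const
        (fun i => if i = 0 then 0 else (a 0 + b 0) / (a i + b 0)) 0 (by simp) ?_
      intro i j
      simp [hB]
    have h2 : B.det = (a 0 + b 0)⁻¹ * (Matrix.of fun i j => u i * (v j * A' i j)).det := by
      rw [Matrix.det_succ_column_zero, Fin.sum_univ_succ, Finset.sum_eq_zero]
      · have : B.submatrix (Fin.succAbove 0) Fin.succ =
            Matrix.of fun i j => u i * (v j * A' i j) := by
          ext i j
          have e1 := h i.succ j.succ
          have e2 := h i.succ 0
          have e3 := h 0 j.succ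
          simp only [hB, hu, hv, hA', Matrix.submatrix_apply, Matrix.of_apply,
            Fin.succAbove_zero, Fin.succ_ne_zero, if_false]
          field_simp
          ring
        rw [this]
        simp [hB]
      · intro i _
        have e2 := h i.succ 0
        have e3 := h 0 0
        have : B i.succ 0 = 0 := by
          simp only [hB, Matrix.of_apply, Fin.succ_ne_zero, if_false]
          field_simp
          ring
        rw [this]; ring
    have h3 : (Matrix.of fun i j => u i * (v j * A' i j)).det = (∏ i, u i) * ((∏ j, v j) * A'.det) := by
      rw [← Matrix.det_mul_row v A', ← Matrix.det_mul_column u]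
      rfl
    rw [h1, h2, h3, Fin.prod_univ_succ, Fin.prod_univ_succ (fun j => a 0 + b j),
      Fin.prod_univ_succ (fun i => ∏ j ∈ Finset.Ioi i, ((a i - a j) * (b i - b j))),
      Fin.prod_Ioi_zero]
    simp only [Fin.prod_Ioi_succ]
    rw [← ih]
    simp only [Fin.prod_univ_succ (fun j => a (Fin.succ _) + b j), Finset.prod_mul_distrib, hu, hv,
      Finset.prod_div_distrib]
    have p1 : ∏ i : Fin n, (a i.succ + b 0) ≠ 0 := Finset.prod_ne_zero_iff.2 fun i _ => h _ _
    have p2 : ∏ i : Fin n, (a 0 + b i.succ) ≠ 0 := Finset.prod_ne_zero_iff.2 fun i _ => h _ _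
    have p0 := h 0 0
    have s1 : (∏ i : Fin n, (a i.succ - a 0)) * (∏ i : Fin n, (b i.succ - b 0)) =
        (∏ i : Fin n, (a 0 - a i.succ)) * (∏ i : Fin n, (b 0 - b i.succ)) := by
      rw [← Finset.prod_mul_distrib, ← Finset.prod_mul_distrib]
      exact Finset.prod_congr rfl fun i _ => by ring
    rw [← s1]
    field_simp

/-- There are `n` points of the unit circle whose mutual distances have product at least one. -/
theorem exists_prod_norm_sub_ge_one : ∀ n : ℕ, ∃ z : Fin n → ℂ, (∀ i, ‖z i‖ = 1) ∧
    1 ≤ ∏ i, ∏ j ∈ Finset.Ioi i, ‖z i - z j‖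
  | 0 => ⟨Fin.elim0, fun i => i.elim0, by simp⟩
  | n + 1 => by
    obtain ⟨z, hz, h⟩ := exists_prod_norm_sub_ge_one n
    -- On the unit circle `|g x|` is the product of the distances from `x` to the old points. As `g
    -- 0 = 1`, the maximum principle supplies a new point with product at least one.
    set g : ℂ → ℂ := fun x => ∏ i, (1 - (starRingEnd ℂ) (z i) * x) with hg
    have hgd : Differentiable ℂ g := by fun_prop
    obtain ⟨x, hx, hm⟩ : ∃ x : ℂ, ‖x‖ = 1 ∧ 1 ≤ ‖g x‖ := by
      by_contra! hcon
      have hK : ∃ x ∈ Metric.sphere (0 : ℂ) 1, IsMaxOn (norm ∘ g) (Metric.sphere (0 : ℂ) 1) x :=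
        (isCompact_sphere _ _).exists_isMaxOn ⟨1, by simp⟩
          (hgd.continuous.norm.continuousOn)
      obtain ⟨x, _, hmax⟩ := hK
      have := Complex.norm_le_of_forall_mem_frontier_norm_le (U := Metric.ball (0 : ℂ) 1)
        Metric.isBounded_ball hgd.diffContOnCl (C := ‖g x‖) (fun y hy => by
          rw [frontier_ball _ one_ne_zero] at hy
          exact hmax hy) (z := 0) (subset_closure (by simp))
      have h1 := hcon x (by simpa using ‹x ∈ Metric.sphere (0 : ℂ) 1›)
      have h2 : g 0 = 1 := by simp [hg]
      rw [h2] at this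
      simp at this
      linarith
    refine ⟨Fin.cons x z, ?_, ?_⟩
    · intro i
      refine Fin.cases ?_ ?_ i
      · simpa using hx
      · intro j; simpa using hz j
    · rw [Fin.prod_univ_succ, Fin.prod_Ioi_zero]
      simp only [Fin.prod_Ioi_succ, Fin.cons_zero, Fin.cons_succ]
      refine le_trans (le_of_eq (one_mul 1).symm) (mul_le_mul ?_ h zero_le_one (by positivity))
      rw [hg] at hm
      simp only [norm_prod] at hm
      refine hm.trans_eq (Finset.prod_congr rfl fun i _ => ?_)
      have e : (starRingEnd ℂ) (z i) * z i = 1 := by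
        rw [mul_comm, Complex.mul_conj]; simp [Complex.normSq_eq_norm_sq, hz]
      have : 1 - (starRingEnd ℂ) (z i) * x = (starRingEnd ℂ) (z i) * (z i - x) := by
        rw [mul_sub, e]
      rw [this, norm_mul, RCLike.norm_conj, hz, one_mul, norm_sub_rev]

theorem norm_det_le {n : ℕ} (A : Matrix (Fin n) (Fin n) ℂ) {c : ℝ} (h : ∀ i j, ‖A i j‖ ≤ c) :
    ‖A.det‖ ≤ n.factorial * c ^ n := by
  simpa using Matrix.det_le (A := A) (abv := IsAbsoluteValue.toAbsoluteValue (norm : ℂ → ℝ)) h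

/-- Exponential growth beats linear growth; this discards the subexponential factors in the
determinant estimate. -/
theorem le_one_of_pow_le_mul {x K : ℝ} (h : ∀ n : ℕ, x ^ n ≤ K * (n + 1)) : x ≤ 1 := by
  by_contra! hx1
  have ht := tendsto_pow_const_div_const_pow_of_one_lt 1 hx1
  have ht0 := tendsto_pow_const_div_const_pow_of_one_lt 0 hx1
  have h3 : Tendsto (fun n : ℕ => K * (((n : ℝ) ^ 1 / x ^ n) + ((n : ℝ) ^ 0 / x ^ n))) atTop
    (𝓝 (K * (0 + 0))) := (ht.add ht0).const_mul K
  rw [add_zero, mul_zero] at h3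
  have := h3.eventually (gt_mem_nhds zero_lt_one)
  obtain ⟨n, hn⟩ := this.exists
  have hp : 0 < x ^ n := by positivity
  have := h n
  rw [← add_div, mul_div_assoc', div_lt_one hp] at hn
  simp at hn
  linarith

/-- Each pair of the `n + 1` points contributes a squared difference to the Cauchy determinant, so
this counts the powers of `s` that can be divided out. -/
theorem two_mul_sum_card_Ioi (n : ℕ) :
    2 * ∑ i : Fin (n + 1), (Finset.Ioi i).card = (n + 1) * n := by
  have h : ∑ i : Fin (n + 1), (Finset.Ioi i).card = ∑ i ∈ Finset.range (n + 1), i := by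
    rw [← Finset.sum_range_reflect, Finset.sum_range]
    exact Finset.sum_congr rfl fun i _ => by simp
  rw [h, mul_comm, Finset.sum_range_id_mul_two]
  simp

/-- Schwarz-type bound for the Cauchy determinants of the kernel `1 / (F z + F w)`. -/
theorem deriv_pow_le_of_add_ne_zero {F : ℂ → ℂ} {R r c : ℝ} (hr : 0 < r) (hrR : r < R)
    (hF : DifferentiableOn ℂ F (Metric.ball 0 R))
    (h : ∀ z ∈ Metric.ball (0 : ℂ) R, ∀ w ∈ Metric.ball (0 : ℂ) R, F z + F w ≠ 0)
    (hc : ∀ z ∈ Metric.closedBall (0 : ℂ) r, ∀ w ∈ Metric.closedBall (0 : ℂ) r,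
      ‖(F z + F w)⁻¹‖ ≤ c) (n : ℕ) :
    (‖deriv F 0‖ * r) ^ ((n + 1) * n) ≤
      (n + 1).factorial * c ^ (n + 1) * (2 * ‖F 0‖) ^ ((n + 1) * (n + 1)) := by
  obtain ⟨z, hz, hprod⟩ := exists_prod_norm_sub_ge_one (n + 1)
  set T := ∑ i : Fin (n + 1), (Finset.Ioi i).card with hT
  have hT2 : (n + 1) * n = 2 * T := (two_mul_sum_card_Ioi n).symm
  have hR : 0 < R := hr.trans hrR
  have hmem : ∀ {ρ : ℝ} {s : ℂ} (i), ‖s‖ < ρ → s * z i ∈ Metric.ball (0 : ℂ) ρ := by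
    intro ρ s i hs; simpa [hz] using hs
  have hFs : ∀ i, DifferentiableOn ℂ (fun s => F (s * z i)) (Metric.ball 0 R) := fun i =>
    hF.comp (by fun_prop) (fun s hs => hmem i (by simpa using hs))
  have hFd : HasDerivAt F (deriv F 0) 0 :=
    (hF.differentiableAt (Metric.isOpen_ball.mem_nhds (by simpa using hR))).hasDerivAt
  have hFsd : ∀ i, HasDerivAt (fun s => F (s * z i)) (deriv F 0 * z i) 0 := fun i => by
    have h1 : HasDerivAt (fun s : ℂ => s * z i) (z i) 0 := by
      simpa using (hasDerivAt_id (0 : ℂ)).mul_const (z i)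
    have h2 : HasDerivAt F (deriv F 0) ((0 : ℂ) * z i) := by simpa using hFd
    exact HasDerivAt.comp (0 : ℂ) h2 h1
  set g : Fin (n + 1) → Fin (n + 1) → ℂ → ℂ :=
    fun i j => dslope (fun s => F (s * z i) - F (s * z j)) 0 with hg
  have hgd : ∀ i j, DifferentiableOn ℂ (g i j) (Metric.ball 0 R) := fun i j =>
    (Complex.differentiableOn_dslope (Metric.isOpen_ball.mem_nhds (by simpa using hR))).2
      ((hFs i).sub (hFs j))
  have hg0 : ∀ i j, g i j 0 = deriv F 0 * (z i - z j) := fun i j => by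
    rw [hg]
    simp only [dslope_same]
    rw [mul_sub]
    exact ((hFsd i).sub (hFsd j)).deriv
  have hgs : ∀ i j s, s ≠ 0 → g i j s = (F (s * z i) - F (s * z j)) / s := fun i j s hs => by
    rw [hg]
    simp only [dslope_of_ne _ hs, slope_def_field]
    simp
  -- For `s ≠ 0` this is the Cauchy determinant of `1 / (F (s z i) + F (s z j))` divided by `s ^ (2
  -- * T)`; the `dslope` factors make it holomorphic at `0`, where it contains `F'(0)` and the
  -- distances of the points. The maximum principle on `|s| = r` compares the two.
  set q : ℂ → ℂ := fun s => (∏ i, ∏ j ∈ Finset.Ioi i, (g i j s * g i j s)) *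
    (∏ i, ∏ j, (F (s * z i) + F (s * z j)))⁻¹ with hq
  have hne : ∀ s ∈ Metric.ball (0 : ℂ) R, ∀ i j, F (s * z i) + F (s * z j) ≠ 0 :=
    fun s hs i j => h _ (hmem i (by simpa using hs)) _ (hmem j (by simpa using hs))
  have hqd : DifferentiableOn ℂ q (Metric.ball 0 R) := by
    refine DifferentiableOn.mul ?_ (DifferentiableOn.inv ?_ ?_)
    · exact DifferentiableOn.fun_finsetProd fun i _ => DifferentiableOn.fun_finsetProd fun j _ =>
        (hgd i j).mul (hgd i j)
    · exact DifferentiableOn.fun_finsetProd fun i _ => DifferentiableOn.fun_finsetProd fun j _ =>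
        (hFs i).add (hFs j)
    · intro s hs
      exact Finset.prod_ne_zero_iff.2 fun i _ => Finset.prod_ne_zero_iff.2 fun j _ => hne s hs i j
  have hbound : ∀ s ∈ Metric.sphere (0 : ℂ) r,
      ‖q s‖ ≤ (n + 1).factorial * c ^ (n + 1) * (r ^ (2 * T))⁻¹ := by
    intro s hs
    have hs1 : ‖s‖ = r := by simpa using hs
    have hs0 : s ≠ 0 := by rintro rfl; simp at hs1; linarith
    have hsR : s ∈ Metric.ball (0 : ℂ) R := by simpa [hs1] using hrR
    have hdet := det_cauchy (n + 1) (fun i => F (s * z i)) (fun i => F (s * z i)) (hne s hsR)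
    have hP : (∏ i, ∏ j, (F (s * z i) + F (s * z j))) ≠ 0 :=
      Finset.prod_ne_zero_iff.2 fun i _ => Finset.prod_ne_zero_iff.2 fun j _ => hne s hsR i j
    have e : q s = (Matrix.of fun i j => (F (s * z i) + F (s * z j))⁻¹).det * (s ^ (2 * T))⁻¹ := by
      have e1 : (∏ i, ∏ j ∈ Finset.Ioi i, (g i j s * g i j s)) =
          (∏ i, ∏ j ∈ Finset.Ioi i, ((F (s * z i) - F (s * z j)) * (F (s * z i) - F (s * z j)))) *
            (s ^ (2 * T))⁻¹ := by
        have e2 : (s ^ (2 * T))⁻¹ = ∏ i : Fin (n + 1), ∏ j ∈ Finset.Ioi i, (s ^ 2)⁻¹ := by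
          simp only [Finset.prod_const]
          rw [Finset.prod_pow_eq_pow_sum, ← hT, pow_mul, inv_pow]
        rw [e2, ← Finset.prod_mul_distrib]
        refine Finset.prod_congr rfl fun i _ => ?_
        rw [← Finset.prod_mul_distrib]
        refine Finset.prod_congr rfl fun j _ => ?_
        rw [hgs i j s hs0]
        field_simp
      simp only [hq]
      rw [e1, ← hdet]
      field_simp
    rw [e, norm_mul, norm_inv, norm_pow, hs1]
    gcongr
    refine norm_det_le _ fun i j => ?_
    exact hc _ (by simp [hz, hs1]) _ (by simp [hz, hs1])
  have hq0 : ‖q 0‖ ≤ (n + 1).factorial * c ^ (n + 1) * (r ^ (2 * T))⁻¹ := by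
    refine Complex.norm_le_of_forall_mem_frontier_norm_le (U := Metric.ball (0 : ℂ) r)
      Metric.isBounded_ball (DifferentiableOn.diffContOnCl ?_) ?_ (subset_closure (by simpa using hr))
    · rw [closure_ball _ hr.ne']
      exact hqd.mono (Metric.closedBall_subset_ball hrR)
    · rw [frontier_ball _ hr.ne']
      exact hbound
  have hF0 : 0 < 2 * ‖F 0‖ := by
    have := h 0 (by simpa using hR) 0 (by simpa using hR)
    rw [← two_mul] at this
    have : F 0 ≠ 0 := right_ne_zero_of_mul this
    positivity
  have hq1 : ‖deriv F 0‖ ^ (2 * T) * ((2 * ‖F 0‖) ^ ((n + 1) * (n + 1)))⁻¹ ≤ ‖q 0‖ := by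
    have e1 : ‖q 0‖ = ‖deriv F 0‖ ^ (2 * T) *
        (∏ i, ∏ j ∈ Finset.Ioi i, ‖z i - z j‖) ^ 2 * ((2 * ‖F 0‖) ^ ((n + 1) * (n + 1)))⁻¹ := by
      simp only [hq, norm_mul, norm_inv, norm_prod, hg0, zero_mul]
      congr 1
      · have e2 : ‖deriv F 0‖ ^ (2 * T) =
            ∏ i : Fin (n + 1), ∏ j ∈ Finset.Ioi i, ‖deriv F 0‖ ^ 2 := by
          simp only [Finset.prod_const]
          rw [Finset.prod_pow_eq_pow_sum, ← hT, pow_mul]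
        rw [e2, ← Finset.prod_pow, ← Finset.prod_mul_distrib]
        refine Finset.prod_congr rfl fun i _ => ?_
        rw [← Finset.prod_pow, ← Finset.prod_mul_distrib]
        exact Finset.prod_congr rfl fun j _ => by ring
      · simp [← two_mul, pow_mul]
    rw [e1]
    gcongr
    exact le_mul_of_one_le_right (by positivity) (one_le_pow₀ hprod)
  have hfin := hq1.trans hq0
  rw [hT2, mul_pow]
  rw [← div_eq_mul_inv, ← div_eq_mul_inv, div_le_div_iff₀ (by positivity) (by positivity)] at hfin
  exact hfin

/-- **Gelfer's inequality**. -/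
theorem norm_deriv_mul_le_of_add_ne_zero {F : ℂ → ℂ} {R : ℝ} (hR : 0 < R)
    (hF : DifferentiableOn ℂ F (Metric.ball 0 R))
    (h : ∀ z ∈ Metric.ball (0 : ℂ) R, ∀ w ∈ Metric.ball (0 : ℂ) R, F z + F w ≠ 0) :
    ‖deriv F 0‖ * R ≤ 2 * ‖F 0‖ := by
  have hF0 : 0 < 2 * ‖F 0‖ := by
    have := h 0 (by simpa using hR) 0 (by simpa using hR)
    rw [← two_mul] at this
    have : F 0 ≠ 0 := right_ne_zero_of_mul this
    positivity
  have key : ∀ r ∈ Ioo 0 R, ‖deriv F 0‖ * r ≤ 2 * ‖F 0‖ := by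
    rintro r ⟨hr, hrR⟩
    have hsub := Metric.closedBall_subset_ball (x := (0 : ℂ)) hrR
    obtain ⟨c, hc⟩ : ∃ c, ∀ p ∈ Metric.closedBall (0 : ℂ) r ×ˢ Metric.closedBall (0 : ℂ) r,
        ‖(F p.1 + F p.2)⁻¹‖ ≤ c := by
      refine ((isCompact_closedBall _ _).prod (isCompact_closedBall _ _)).exists_bound_of_continuousOn ?_
      refine ContinuousOn.inv₀ ?_ fun p hp => h _ (hsub hp.1) _ (hsub hp.2)
      exact (hF.continuousOn.comp continuousOn_fst fun p hp => hsub hp.1).add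
        (hF.continuousOn.comp continuousOn_snd fun p hp => hsub hp.2)
    have hc0 : 0 ≤ c := (norm_nonneg _).trans (hc (0, 0) (by simp [hr.le]))
    rw [← div_le_one hF0]
    -- The bound is the `(n + 1)`-th root of the previous estimate, using `(n + 1)! ≤ (n + 1) ^ (n +
    -- 1)`; the surplus factor `2 * ‖F 0‖` goes into `K`.
    refine le_one_of_pow_le_mul (K := 2 * ‖F 0‖ * c) fun n => ?_
    have := deriv_pow_le_of_add_ne_zero hr hrR hF h (fun z hz w hw => hc (z, w) ⟨hz, hw⟩) n
    have hfac : ((n + 1).factorial : ℝ) ≤ ((n : ℝ) + 1) ^ (n + 1) := by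
      exact_mod_cast Nat.factorial_le_pow (n + 1)
    rw [← pow_le_pow_iff_left₀ (n := n + 1) (by positivity) (by positivity) (by simp), ← pow_mul,
      mul_comm n, div_pow, div_le_iff₀ (by positivity)]
    refine this.trans ?_
    calc ((n + 1).factorial : ℝ) * c ^ (n + 1) * (2 * ‖F 0‖) ^ ((n + 1) * (n + 1))
        ≤ ((n : ℝ) + 1) ^ (n + 1) * c ^ (n + 1) * (2 * ‖F 0‖) ^ ((n + 1) * (n + 1)) := by gcongr
      _ = _ := by rw [mul_pow, mul_pow, mul_pow]; ring
  have hlim : Tendsto (fun r => ‖deriv F 0‖ * r) (𝓝[<] R) (𝓝 (‖deriv F 0‖ * R)) :=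
    ((continuous_const.mul continuous_id).tendsto R).mono_left nhdsWithin_le_nhds
  refine le_of_tendsto hlim ?_
  filter_upwards [Ioo_mem_nhdsLT hR] with r hr using key r hr

/-! ### Continuous logarithms, univalent maps and square roots. -/

/-- Every nonvanishing continuous complex function on `U` has a continuous logarithm. -/
def HasContinuousLogs {X : Type*} [TopologicalSpace X] (U : Set X) : Prop :=
  ∀ f : X → ℂ, ContinuousOn f U → (∀ x ∈ U, f x ≠ 0) →
    ∃ g : X → ℂ, ContinuousOn g U ∧ ∀ x ∈ U, Complex.exp (g x) = f x

theorem IsSimplyConnected.hasContinuousLogs {X : Type*} [TopologicalSpace X]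
    [LocallyPathConnectedSpace X] {U : Set X} (hU : IsSimplyConnected U) (ho : IsOpen U) :
    HasContinuousLogs U := fun f hf h0 =>
  Complex.exists_continuousOn_eqOn_exp_comp hU ho hf (by rintro ⟨x, hx, h⟩; exact h0 x hx h)

theorem Convex.hasContinuousLogs {E : Type*} [NormedAddCommGroup E] [NormedSpace ℝ E] {U : Set E}
    (hU : Convex ℝ U) (ho : IsOpen U) : HasContinuousLogs U := by
  rcases U.eq_empty_or_nonempty with rfl | hne
  · exact fun f _ _ => ⟨0, continuousOn_empty _, by simp⟩
  · have : ContractibleSpace U := hU.contractibleSpace hne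
    have : IsSimplyConnected U := SimplyConnectedSpace.ofContractible U
    exact this.hasContinuousLogs ho

/-- A holomorphic injection with nowhere vanishing derivative. -/
structure IsUnivalentOn (f : ℂ → ℂ) (D : Set ℂ) : Prop where
  differentiableOn : DifferentiableOn ℂ f D
  injOn : InjOn f D
  deriv_ne_zero : ∀ z ∈ D, deriv f z ≠ 0

theorem IsUnivalentOn.hasDerivAt {f : ℂ → ℂ} {D : Set ℂ} (hf : IsUnivalentOn f D) (hD : IsOpen D)
    {z : ℂ} (hz : z ∈ D) : HasDerivAt f (deriv f z) z :=
  (hf.differentiableOn.differentiableAt (hD.mem_nhds hz)).hasDerivAt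

theorem IsUnivalentOn.comp {f g : ℂ → ℂ} {D E : Set ℂ} (hg : IsUnivalentOn g E)
    (hf : IsUnivalentOn f D) (hE : IsOpen E) (hD : IsOpen D) (h : MapsTo f D E) :
    IsUnivalentOn (g ∘ f) D where
  differentiableOn := hg.differentiableOn.comp hf.differentiableOn h
  injOn := hg.injOn.comp hf.injOn h
  deriv_ne_zero z hz := by
    rw [((hg.hasDerivAt hE (h hz)).comp z (hf.hasDerivAt hD hz)).deriv]
    exact mul_ne_zero (hg.deriv_ne_zero _ (h hz)) (hf.deriv_ne_zero _ hz)

theorem IsUnivalentOn.map_nhds_eq {f : ℂ → ℂ} {D : Set ℂ} (hf : IsUnivalentOn f D) (hD : IsOpen D)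
    {z : ℂ} (hz : z ∈ D) : map f (𝓝 z) = 𝓝 (f z) :=
  (hf.differentiableOn.analyticAt (hD.mem_nhds hz)).hasStrictDerivAt.map_nhds_eq
    (hf.deriv_ne_zero z hz)

/-- The inverse of a univalent function is holomorphic. -/
theorem IsUnivalentOn.hasDerivAt_leftInverse {f F : ℂ → ℂ} {D : Set ℂ} (hf : IsUnivalentOn f D)
    (hD : IsOpen D) (hF : ∀ z ∈ D, F (f z) = z) {z : ℂ} (hz : z ∈ D) :
    HasDerivAt F (deriv f z)⁻¹ (f z) := by
  have hev : ∀ᶠ y in 𝓝 (f z), f (F y) = y := by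
    rw [← hf.map_nhds_eq hD hz, eventually_map]
    filter_upwards [hD.mem_nhds hz] with w hw
    rw [hF w hw]
  have hc : ContinuousAt F (f z) := by
    rw [ContinuousAt, hF z hz, ← hf.map_nhds_eq hD hz, tendsto_map'_iff]
    refine tendsto_id.congr' ?_
    filter_upwards [hD.mem_nhds hz] with w hw
    exact (hF w hw).symm
  refine HasDerivAt.of_local_left_inverse hc ?_ (hf.deriv_ne_zero z hz) hev
  rw [hF z hz]
  exact hf.hasDerivAt hD hz

/-- A continuous square root of a nonvanishing holomorphic function is holomorphic. -/
theorem HasDerivAt.of_sq_eq {f S : ℂ → ℂ} {f' z : ℂ} (hf : HasDerivAt f f' z)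
    (hS : ContinuousAt S z) (h : ∀ᶠ w in 𝓝 z, S w ^ 2 = f w) (h0 : f z ≠ 0) :
    HasDerivAt S (f' / (2 * S z)) z := by
  have hSz : S z ≠ 0 := by
    intro h1
    apply h0
    rw [← h.self_of_nhds, h1]
    simp
  rw [hasDerivAt_iff_tendsto_slope] at hf ⊢
  -- Since `S w ^ 2 - S z ^ 2 = (S w - S z) (S w + S z)`, the slope of `S` is the slope of `f`
  -- divided by this sum.
  have hsum : Tendsto (fun w => S w + S z) (𝓝[≠] z) (𝓝 (2 * S z)) := by
    rw [two_mul]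
    exact (hS.tendsto.add_const _).mono_left nhdsWithin_le_nhds
  refine (hf.div hsum (by simpa using hSz)).congr' ?_
  have hne : ∀ᶠ w in 𝓝[≠] z, S w + S z ≠ 0 :=
    hsum.eventually_ne (by simpa using hSz)
  filter_upwards [hne, nhdsWithin_le_nhds h, self_mem_nhdsWithin] with w hw1 hw2 hw3
  have hwz : w - z ≠ 0 := sub_ne_zero.2 hw3
  rw [Pi.div_apply, slope_def_field, slope_def_field, ← hw2, ← h.self_of_nhds]
  field_simp
  ring

theorem HasContinuousLogs.exists_sqrt {D : Set ℂ} (hD : IsOpen D) (hlog : HasContinuousLogs D)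
    {f : ℂ → ℂ} (hf : DifferentiableOn ℂ f D) (h0 : ∀ z ∈ D, f z ≠ 0) :
    ∃ S : ℂ → ℂ, (∀ z ∈ D, S z ^ 2 = f z) ∧
      ∀ z ∈ D, HasDerivAt S (deriv f z / (2 * S z)) z := by
  obtain ⟨g, hg, hexp⟩ := hlog f hf.continuousOn h0
  have hsq : ∀ z ∈ D, (Complex.exp (g z / 2)) ^ 2 = f z := fun z hz => by
    rw [← Complex.exp_nat_mul, ← hexp z hz]
    congr 1
    push_cast
    ring
  refine ⟨fun z => Complex.exp (g z / 2), hsq, fun z hz => ?_⟩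
  have hDz := hD.mem_nhds hz
  refine HasDerivAt.of_sq_eq (hf.differentiableAt hDz).hasDerivAt ?_ ?_ (h0 z hz)
  · exact (((hg.continuousAt hDz).div_const 2)).cexp
  · filter_upwards [hDz] with w hw using hsq w hw

theorem IsUnivalentOn.exists_sqrt {D : Set ℂ} (hD : IsOpen D) (hlog : HasContinuousLogs D)
    {f : ℂ → ℂ} (hf : IsUnivalentOn f D) (h0 : ∀ z ∈ D, f z ≠ 0) :
    ∃ S : ℂ → ℂ, IsUnivalentOn S D ∧ (∀ z ∈ D, S z ^ 2 = f z) ∧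
      ∀ z ∈ D, deriv S z = deriv f z / (2 * S z) := by
  obtain ⟨S, hS, hd⟩ := hlog.exists_sqrt hD hf.differentiableOn h0
  refine ⟨S, ⟨fun z hz => (hd z hz).differentiableAt.differentiableWithinAt, ?_, ?_⟩, hS,
    fun z hz => (hd z hz).deriv⟩
  · intro z hz w hw h
    exact hf.injOn hz hw (by rw [← hS z hz, ← hS w hw, h])
  · intro z hz
    rw [(hd z hz).deriv]
    refine div_ne_zero (hf.deriv_ne_zero z hz) (mul_ne_zero two_ne_zero fun h => h0 z hz ?_)
    rw [← hS z hz, h]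
    simp

/-! ### Maps onto large parts of the disc, and Koebe's theorem. -/

/-- The automorphism of the unit disc that sends `c` to `0`. -/
noncomputable def discAut (c z : ℂ) : ℂ := (z - c) / (1 - (starRingEnd ℂ) c * z)

theorem one_sub_conj_mul_ne_zero {c z : ℂ} (hc : ‖c‖ < 1) (hz : ‖z‖ < 1) :
    1 - (starRingEnd ℂ) c * z ≠ 0 := by
  intro h
  have h1 : ‖(starRingEnd ℂ) c * z‖ = 1 := by rw [← sub_eq_zero.1 h]; simp
  rw [norm_mul, RCLike.norm_conj] at h1
  nlinarith [norm_nonneg c, norm_nonneg z]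

theorem norm_discAut_lt_one {c z : ℂ} (hc : ‖c‖ < 1) (hz : ‖z‖ < 1) : ‖discAut c z‖ < 1 := by
  have h := one_sub_conj_mul_ne_zero hc hz
  rw [discAut, norm_div, div_lt_one (norm_pos_iff.2 h),
    ← sq_lt_sq₀ (norm_nonneg _) (norm_nonneg _)]
  have e : ‖1 - (starRingEnd ℂ) c * z‖ ^ 2 - ‖z - c‖ ^ 2 = (1 - ‖c‖ ^ 2) * (1 - ‖z‖ ^ 2) := by
    simp only [← Complex.normSq_eq_norm_sq, Complex.normSq_apply]
    simp
    ring
  have h1 : 0 < 1 - ‖c‖ ^ 2 := by nlinarith [norm_nonneg c]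
  have h2 : 0 < 1 - ‖z‖ ^ 2 := by nlinarith [norm_nonneg z]
  nlinarith [mul_pos h1 h2]

theorem hasDerivAt_discAut {c z : ℂ} (hc : ‖c‖ < 1) (hz : ‖z‖ < 1) :
    HasDerivAt (discAut c) ((1 - (‖c‖ : ℂ) ^ 2) / (1 - (starRingEnd ℂ) c * z) ^ 2) z := by
  have h1 : HasDerivAt (fun z => z - c) 1 z := (hasDerivAt_id z).sub_const c
  have h2 : HasDerivAt (fun z => 1 - (starRingEnd ℂ) c * z) (-(starRingEnd ℂ) c) z := by
    simpa using ((hasDerivAt_id z).const_mul ((starRingEnd ℂ) c)).const_sub 1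
  refine (h1.div h2 (one_sub_conj_mul_ne_zero hc hz)).congr_deriv ?_
  congr 1
  have : (starRingEnd ℂ) c * c = (‖c‖ : ℂ) ^ 2 := by
    rw [mul_comm, Complex.mul_conj, Complex.normSq_eq_norm_sq]; push_cast; rfl
  rw [← this]
  ring

theorem isUnivalentOn_discAut {c : ℂ} (hc : ‖c‖ < 1) :
    IsUnivalentOn (discAut c) (Metric.ball 0 1) where
  differentiableOn z hz :=
    (hasDerivAt_discAut hc (by simpa using hz)).differentiableAt.differentiableWithinAt
  injOn z hz w hw h := by
    have hz := one_sub_conj_mul_ne_zero hc (by simpa using hz)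
    have hw := one_sub_conj_mul_ne_zero hc (by simpa using hw)
    rw [discAut, discAut, div_eq_div_iff hz hw] at h
    have hcc : (starRingEnd ℂ) c * c = (‖c‖ : ℂ) ^ 2 := by
      rw [mul_comm, Complex.mul_conj, Complex.normSq_eq_norm_sq]; push_cast; rfl
    have h1 : (1 - (‖c‖ : ℂ) ^ 2) * (z - w) = 0 := by
      rw [← hcc]
      linear_combination h
    have h2 : (1 - (‖c‖ : ℂ) ^ 2) ≠ 0 := by
      have : (1 - ‖c‖ ^ 2) ≠ 0 := by nlinarith [norm_nonneg c]
      exact_mod_cast this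
    exact sub_eq_zero.1 ((mul_eq_zero.1 h1).resolve_left h2)
  deriv_ne_zero z hz := by
    have hz := (by simpa using hz : ‖z‖ < 1)
    rw [(hasDerivAt_discAut hc hz).deriv]
    refine div_ne_zero ?_ (pow_ne_zero _ (one_sub_conj_mul_ne_zero hc hz))
    have : (1 - ‖c‖ ^ 2) ≠ 0 := by nlinarith [norm_nonneg c]
    exact_mod_cast this

theorem discAut_self (c : ℂ) : discAut c c = 0 := by simp [discAut]

theorem mapsTo_discAut {c : ℂ} (hc : ‖c‖ < 1) :
    MapsTo (discAut c) (Metric.ball 0 1) (Metric.ball 0 1) := fun z hz => by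
  simpa using norm_discAut_lt_one hc (by simpa using hz)

/-- Univalent maps of `D` into the unit disc that vanish at the origin. -/
structure IsDiscMap (f : ℂ → ℂ) (D : Set ℂ) : Prop extends IsUnivalentOn f D where
  mapsTo : MapsTo f D (Metric.ball 0 1)
  map_zero : f 0 = 0

/-- Koebe's square root transformation. -/
theorem IsDiscMap.exists_deriv_eq {D : Set ℂ} (hD : IsOpen D) (hlog : HasContinuousLogs D)
    (h0 : (0 : ℂ) ∈ D) {f : ℂ → ℂ} (hf : IsDiscMap f D) {c : ℂ} (hc : ‖c‖ < 1)
    (hcf : c ∉ f '' D) :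
    ∃ g : ℂ → ℂ, IsDiscMap g D ∧
      ‖deriv g 0‖ = ‖deriv f 0‖ * ((1 + ‖c‖) / (2 * √‖c‖)) := by
  have hc0 : c ≠ 0 := by
    rintro rfl
    exact hcf ⟨0, h0, hf.map_zero⟩
  have hcpos : 0 < ‖c‖ := norm_pos_iff.2 hc0
  have hU := (isUnivalentOn_discAut hc).comp hf.toIsUnivalentOn Metric.isOpen_ball hD hf.mapsTo
  have hne : ∀ z ∈ D, (discAut c ∘ f) z ≠ 0 := by
    intro z hz h
    have hz1 : ‖f z‖ < 1 := by simpa using hf.mapsTo hz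
    have h1 := (div_eq_zero_iff.1 h).resolve_right (one_sub_conj_mul_ne_zero hc hz1)
    exact hcf ⟨z, hz, sub_eq_zero.1 h1⟩
  obtain ⟨S, hS, hsq, hd⟩ := hU.exists_sqrt hD hlog hne
  have hSm : MapsTo S D (Metric.ball 0 1) := by
    intro z hz
    have h1 : ‖S z‖ ^ 2 < 1 := by
      rw [← norm_pow, hsq z hz]
      exact norm_discAut_lt_one hc (by simpa using hf.mapsTo hz)
    have : ‖S z‖ < 1 := by nlinarith [norm_nonneg (S z)]
    simpa using this
  have hS0 : ‖S 0‖ < 1 := by simpa using hSm h0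
  have hS0c : ‖S 0‖ ^ 2 = ‖c‖ := by
    rw [← norm_pow, hsq 0 h0]
    simp [hf.map_zero, discAut]
  have hS0s : ‖S 0‖ = √‖c‖ := by
    rw [← hS0c, Real.sqrt_sq (norm_nonneg _)]
  -- With `|S 0|² = |c|`, the three stages multiply the derivative at `0` in modulus by `1 - |c|²`,
  -- `1 / (2√|c|)` and `1 / (1 - |c|)`.
  refine ⟨discAut (S 0) ∘ S,
    ⟨(isUnivalentOn_discAut hS0).comp hS Metric.isOpen_ball hD hSm,
      (mapsTo_discAut hS0).comp hSm, discAut_self _⟩, ?_⟩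
  rw [((hasDerivAt_discAut hS0 hS0).comp (0 : ℂ) (hS.hasDerivAt hD h0)).deriv, hd 0 h0]
  have hf0 : ‖f 0‖ < 1 := by simp [hf.map_zero]
  rw [((hasDerivAt_discAut hc hf0).comp (0 : ℂ) (hf.hasDerivAt hD h0)).deriv, hf.map_zero]
  have hcc : (starRingEnd ℂ) (S 0) * S 0 = ((‖S 0‖ ^ 2 : ℝ) : ℂ) := by
    rw [mul_comm, Complex.mul_conj, Complex.normSq_eq_norm_sq]
  rw [hcc, hS0c]
  have e1 : ‖(1 - (‖S 0‖ : ℂ) ^ 2)‖ = 1 - ‖c‖ := by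
    rw [← hS0c]
    have : (1 - (‖S 0‖ : ℂ) ^ 2) = ((1 - ‖S 0‖ ^ 2 : ℝ) : ℂ) := by push_cast; rfl
    rw [this, Complex.norm_real, Real.norm_of_nonneg]
    nlinarith [norm_nonneg (S 0)]
  have e2 : ‖(1 - ((‖c‖ : ℝ) : ℂ))‖ = 1 - ‖c‖ := by
    have : (1 - ((‖c‖ : ℝ) : ℂ)) = ((1 - ‖c‖ : ℝ) : ℂ) := by push_cast; rfl
    rw [this, Complex.norm_real, Real.norm_of_nonneg]
    linarith
  have e3 : ‖(1 - (‖c‖ : ℂ) ^ 2)‖ = (1 - ‖c‖) * (1 + ‖c‖) := by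
    have : (1 - (‖c‖ : ℂ) ^ 2) = ((1 - ‖c‖ ^ 2 : ℝ) : ℂ) := by push_cast; rfl
    rw [this, Complex.norm_real, Real.norm_of_nonneg]
    · ring
    · nlinarith
  simp only [norm_mul, norm_div, norm_pow, e1, e2, e3, mul_zero, sub_zero,
    Complex.norm_ofNat, one_pow, div_one]
  rw [hS0s]
  have h1c : 1 - ‖c‖ ≠ 0 := by linarith
  have hsp : √‖c‖ ≠ 0 := (Real.sqrt_pos.2 hcpos).ne'
  field_simp

/-- A square root `S` of `1 - z` never takes two opposite values. Since `S` covers a disc about `S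
0`, it avoids the opposite disc about `-S 0`, and inversion in `-S 0` makes it bounded. -/
theorem exists_isDiscMap {D : Set ℂ} (hD : IsOpen D) (hlog : HasContinuousLogs D)
    (h0 : (0 : ℂ) ∈ D) (h1 : (1 : ℂ) ∉ D) : ∃ f, IsDiscMap f D := by
  have hlin : IsUnivalentOn (fun z => 1 - z) D :=
    ⟨by fun_prop, fun z _ w _ h => by simpa using h, fun z _ => by simp⟩
  have hne : ∀ z ∈ D, (1 - z) ≠ 0 := fun z hz h => h1 (by rwa [sub_eq_zero.1 h])
  obtain ⟨S, hS, hsq, -⟩ := hlin.exists_sqrt hD hlog hne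
  have himg : S '' D ∈ 𝓝 (S 0) := by
    rw [← hS.map_nhds_eq hD h0]
    exact image_mem_map (hD.mem_nhds h0)
  obtain ⟨ε, hε, hball⟩ := Metric.mem_nhds_iff.1 himg
  have hfar : ∀ z ∈ D, ε ≤ ‖S z + S 0‖ := by
    intro z hz
    by_contra! hlt
    obtain ⟨w, hw, hwz⟩ := hball (show -S z ∈ Metric.ball (S 0) ε by
      rwa [mem_ball_iff_norm, ← norm_neg, neg_sub, sub_neg_eq_add, add_comm])
    have hzw : w = z := by
      have := hsq w hw
      rw [hwz, neg_sq, hsq z hz] at this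
      linear_combination this
    rw [hzw] at hwz
    have : S z = 0 := self_eq_neg.1 hwz
    apply hne z hz
    rw [← hsq z hz, this]
    simp
  have hpos : ∀ z ∈ D, S z + S 0 ≠ 0 := fun z hz h => by
    have := hfar z hz
    rw [h, norm_zero] at this
    linarith
  have hmap : MapsTo S D {w | w + S 0 ≠ 0} := hpos
  have hinv : IsUnivalentOn (fun w => (ε / 2 : ℂ) / (w + S 0)) {w | w + S 0 ≠ 0} := by
    have hε2 : (ε / 2 : ℂ) ≠ 0 := by
      have : (ε : ℂ) ≠ 0 := by exact_mod_cast hε.ne'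
      simpa using this
    have hder : ∀ w ∈ {w | w + S 0 ≠ 0},
        HasDerivAt (fun w => (ε / 2 : ℂ) / (w + S 0)) (-(ε / 2 : ℂ) / (w + S 0) ^ 2) w := by
      intro w hw
      have := (hasDerivAt_const w (ε / 2 : ℂ)).div ((hasDerivAt_id w).add_const (S 0)) hw
      simpa [Function.comp_def, Pi.div_def] using this
    refine ⟨fun w hw => (hder w hw).differentiableAt.differentiableWithinAt, ?_, ?_⟩
    · intro w hw v hv h
      have := (div_eq_div_iff hw hv).1 h
      have := mul_left_cancel₀ hε2 this
      linear_combination -this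
    · intro w hw
      rw [(hder w hw).deriv]
      exact div_ne_zero (neg_ne_zero.2 hε2) (pow_ne_zero _ hw)
  have hopen : IsOpen {w | w + S 0 ≠ 0} := isOpen_ne_fun (by fun_prop) (by fun_prop)
  have hU := hinv.comp hS hopen hD hmap
  have hm : MapsTo ((fun w => (ε / 2 : ℂ) / (w + S 0)) ∘ S) D (Metric.ball 0 1) := by
    intro z hz
    have hz1 := hfar z hz
    have : ‖(ε / 2 : ℂ)‖ = ε / 2 := by
      simp [abs_of_pos hε]
    rw [mem_ball_zero_iff, Function.comp_apply, norm_div, this, div_lt_one (by linarith)]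
    linarith
  set φ := (fun w => (ε / 2 : ℂ) / (w + S 0)) ∘ S
  have hφ0 : ‖φ 0‖ < 1 := by simpa using hm h0
  exact ⟨discAut (φ 0) ∘ φ, (isUnivalentOn_discAut hφ0).comp hU Metric.isOpen_ball hD hm,
    (mapsTo_discAut hφ0).comp hm, discAut_self _⟩

/-- The gain of Koebe's transformation is `(√s + 1/√s) / 2`, which decreases on `(0, 1)`. A uniform
gain is thus available while the omitted value stays in a fixed smaller disc. -/
theorem one_add_div_two_mul_sqrt_ge {t s : ℝ} (ht : 0 < t) (hts : t ≤ s) (hs : s < 1) :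
    (1 + s) / (2 * √s) ≤ (1 + t) / (2 * √t) := by
  have h1 : 0 < √t := Real.sqrt_pos.2 ht
  have h2 : √t ≤ √s := Real.sqrt_le_sqrt hts
  have h3 : √s < 1 := by
    rw [Real.sqrt_lt' one_pos]
    simpa using hs
  have e1 := Real.sq_sqrt ht.le
  have e2 := Real.sq_sqrt (ht.le.trans hts)
  rw [div_le_div_iff₀ (by linarith) (by linarith)]
  set a := √t
  set b := √s
  rw [← e1, ← e2]
  nlinarith [mul_nonneg (sub_nonneg.2 h2) (show 0 ≤ 1 - a * b by nlinarith)]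

theorem one_lt_one_add_div_two_mul_sqrt {s : ℝ} (hs0 : 0 < s) (hs : s < 1) :
    1 < (1 + s) / (2 * √s) := by
  have h1 : 0 < √s := Real.sqrt_pos.2 hs0
  have h3 : √s < 1 := by
    rw [Real.sqrt_lt' one_pos]
    simpa using hs
  have e2 := Real.sq_sqrt hs0.le
  rw [one_lt_div (by linarith)]
  nlinarith [mul_pos (sub_pos.2 h3) (sub_pos.2 h3)]

/-- An approximate Riemann mapping theorem. -/
theorem exists_isDiscMap_ball_subset {D : Set ℂ} (hD : IsOpen D) (hlog : HasContinuousLogs D)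
    (h0 : (0 : ℂ) ∈ D) (h1 : (1 : ℂ) ∉ D) {r : ℝ} (hr0 : 0 < r) (hr : r < 1) :
    ∃ f, IsDiscMap f D ∧ Metric.ball 0 r ⊆ f '' D := by
  by_contra! hcon
  obtain ⟨ρ, hρ, hball⟩ := Metric.isOpen_iff.1 hD 0 h0
  set A : Set ℝ := {x | ∃ f, IsDiscMap f D ∧ x = ‖deriv f 0‖} with hA
  have hAbdd : BddAbove A := by
    -- Schwarz's lemma on a disc of radius `ρ` inside `D`.
    refine ⟨1 / ρ, ?_⟩
    rintro _ ⟨f, hf, rfl⟩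
    refine Complex.norm_deriv_le_div_of_mapsTo_ball (hf.differentiableOn.mono hball) ?_ hρ
    intro z hz
    rw [hf.map_zero]
    exact Metric.ball_subset_closedBall (hf.mapsTo (hball hz))
  obtain ⟨f₀, hf₀⟩ := exists_isDiscMap hD hlog h0 h1
  set K := (1 + r) / (2 * √r) with hK
  have hK1 : 1 < K := one_lt_one_add_div_two_mul_sqrt hr0 hr
  -- If every image misses a point of the disc of radius `r`, each derivative can be enlarged by the
  -- fixed factor `K > 1`, contradicting the finite positive supremum. No extremal map is needed.
  have hstep : ∀ x ∈ A, x * K ≤ sSup A := by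
    rintro _ ⟨f, hf, rfl⟩
    obtain ⟨c, hc, hcf⟩ := not_subset.1 (hcon f hf)
    have hc' : ‖c‖ < r := by simpa using hc
    obtain ⟨g, hg, hgf⟩ := hf.exists_deriv_eq hD hlog h0 (hc'.trans hr) hcf
    have hc0 : c ≠ 0 := by
      rintro rfl
      exact hcf ⟨0, h0, hf.map_zero⟩
    refine le_trans ?_ (le_csSup hAbdd ⟨g, hg, rfl⟩)
    rw [hgf]
    exact mul_le_mul_of_nonneg_left
      (one_add_div_two_mul_sqrt_ge (norm_pos_iff.2 hc0) hc'.le hr) (norm_nonneg _)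
  have hle : sSup A ≤ sSup A / K :=
    csSup_le ⟨_, f₀, hf₀, rfl⟩ fun x hx => by
      rw [le_div_iff₀ (by linarith)]
      exact hstep x hx
  have hpos : 0 < sSup A :=
    (norm_pos_iff.2 (hf₀.deriv_ne_zero 0 h0)).trans_le (le_csSup hAbdd ⟨f₀, hf₀, rfl⟩)
  have := div_lt_self hpos hK1
  linarith

/-- **Koebe's one-quarter theorem**, for maps from a domain that omits `1` into the disc. -/
theorem exists_mapsTo_ball_deriv_ge {D : Set ℂ} (hD : IsOpen D) (hlog : HasContinuousLogs D)
    (h0 : (0 : ℂ) ∈ D) (h1 : (1 : ℂ) ∉ D) {r : ℝ} (hr0 : 0 < r) (hr : r < 1) :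
    ∃ f, IsDiscMap f D ∧ r / 4 ≤ ‖deriv f 0‖ := by
  obtain ⟨f, hf, hsub⟩ := exists_isDiscMap_ball_subset hD hlog h0 h1 hr0 hr
  refine ⟨f, hf, ?_⟩
  set F := Function.invFunOn f D with hF
  have hFD : ∀ y ∈ Metric.ball (0 : ℂ) r, F y ∈ D ∧ f (F y) = y := fun y hy =>
    ⟨Function.invFunOn_mem (hsub hy), Function.invFunOn_eq (hsub hy)⟩
  have hFf : ∀ z ∈ D, F (f z) = z := fun z hz => hf.injOn.leftInvOn_invFunOn hz
  have hFd : ∀ y ∈ Metric.ball (0 : ℂ) r, HasDerivAt F (deriv f (F y))⁻¹ y := fun y hy => by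
    have := hf.hasDerivAt_leftInverse hD hFf (hFD y hy).1
    rwa [(hFD y hy).2] at this
  have hmem0 : (0 : ℂ) ∈ Metric.ball (0 : ℂ) r := by simpa using hr0
  have hF0 : F 0 = 0 := by
    have := hFf 0 h0
    rwa [hf.map_zero] at this
  have hgd : ∀ y ∈ Metric.ball (0 : ℂ) r,
      HasDerivAt (fun y => 1 - F y) (-(deriv f (F y))⁻¹) y := fun y hy => (hFd y hy).const_sub 1
  obtain ⟨S, hS, hSd⟩ :=
    ((convex_ball (0 : ℂ) r).hasContinuousLogs Metric.isOpen_ball).exists_sqrt Metric.isOpen_ball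
      (f := fun y => 1 - F y) (fun y hy => (hgd y hy).differentiableAt.differentiableWithinAt)
      (fun y hy h => h1 (by rw [sub_eq_zero.1 h]; exact (hFD y hy).1))
  -- Opposite values of `S` have equal squares `1 - F`, hence equal arguments by injectivity of `F`,
  -- hence are zero; but `F` omits `1`. Gelfer's inequality then reads `|F'(0)| r / 2 ≤ 2`.
  have hsum : ∀ z ∈ Metric.ball (0 : ℂ) r, ∀ w ∈ Metric.ball (0 : ℂ) r, S z + S w ≠ 0 := by
    intro z hz w hw h
    have hSz : S z = -S w := eq_neg_of_add_eq_zero_left h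
    have e : 1 - F z = 1 - F w := by
      rw [← hS z hz, ← hS w hw, hSz, neg_sq]
    have hzw : z = w := by
      rw [← (hFD z hz).2, ← (hFD w hw).2, sub_right_injective e]
    subst hzw
    have : S z = 0 := self_eq_neg.1 hSz
    apply h1
    have h2 := hS z hz
    rw [this] at h2
    have : F z = 1 := by linear_combination h2
    rw [← this]
    exact (hFD z hz).1
  have key := norm_deriv_mul_le_of_add_ne_zero hr0
    (fun y hy => (hSd y hy).differentiableAt.differentiableWithinAt) hsum
  have hS0 : S 0 ^ 2 = 1 := by rw [hS 0 hmem0, hF0, sub_zero]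
  have hS0n : ‖S 0‖ = 1 := by
    have : ‖S 0‖ ^ 2 = 1 := by rw [← norm_pow, hS0, norm_one]
    exact (pow_eq_one_iff_of_nonneg (norm_nonneg _) two_ne_zero).1 this
  rw [(hSd 0 hmem0).deriv, (hgd 0 hmem0).deriv, hF0, norm_div, norm_neg, norm_inv, norm_mul,
    hS0n, Complex.norm_ofNat] at key
  have hpos := norm_pos_iff.2 (hf.deriv_ne_zero 0 h0)
  field_simp at key
  linarith

/-! ### Competitors for the Green function from maps into the disc. -/

theorem log_enorm_of_ne_zero {z : ℂ} (hz : z ≠ 0) :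
    ENNReal.log ‖z‖ₑ = (Real.log ‖z‖ : EReal) := by
  rw [ENNReal.log_pos_real (by simpa using hz) (by simp)]
  simp

theorem log_enorm_nonpos {z : ℂ} (hz : ‖z‖ ≤ 1) : ENNReal.log ‖z‖ₑ ≤ 0 := by
  rw [← ENNReal.log_one]
  refine ENNReal.log_monotone ?_
  rw [← ofReal_norm]
  exact ENNReal.ofReal_le_one.2 hz

/-- The sub-mean value inequality for `log |h|`. -/
theorem log_enorm_le_angularMean {h : ℂ → ℂ} (hh : AnalyticOnNhd ℂ h (Metric.closedBall 0 1))
    (h1 : ∀ z ∈ Metric.closedBall (0 : ℂ) 1, ‖h z‖ ≤ 1) :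
    ENNReal.log ‖h 0‖ₑ ≤ angularMean fun θ => ENNReal.log ‖h (circleMap 0 1 θ)‖ₑ := by
  by_cases h0 : h 0 = 0
  · simp [h0]
  have hcirc : ∀ θ, circleMap 0 1 θ ∈ Metric.closedBall (0 : ℂ) 1 := fun θ =>
    Metric.sphere_subset_closedBall (circleMap_mem_sphere 0 zero_le_one θ)
  set s : Set ℝ := Ioc 0 (2 * Real.pi) with hs
  have hpi : 0 < 2 * Real.pi := Real.two_pi_pos
  -- The zeros of `h` are isolated because `h 0 ≠ 0`, so they form a null set on the circle and the
  -- value `-∞` does not affect the mean.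
  have hne : ∀ᵐ θ ∂(volume.restrict s), h (circleMap 0 1 θ) ≠ 0 := by
    have hcod : ∀ᶠ z in codiscreteWithin (Metric.closedBall (0 : ℂ) 1), h z ≠ 0 := by
      refine (hh.eqOn_zero_or_eventually_ne_zero_of_preconnected
        (convex_closedBall _ _).isPreconnected).resolve_left fun he => h0 (he (by simp))
    have h2 : ∀ᶠ z in codiscreteWithin (Metric.sphere (0 : ℂ) |1|), h z ≠ 0 :=
      codiscreteWithin_mono (by rw [abs_one]; exact Metric.sphere_subset_closedBall) hcod
    have h3 := circleMap_preimage_codiscrete one_ne_zero h2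
    exact ae_restrict_le_codiscreteWithin measurableSet_Ioc
      (codiscreteWithin_mono (subset_univ _) h3)
  have hint : IntegrableOn (fun θ => -Real.log ‖h (circleMap 0 1 θ)‖) s := by
    have : CircleIntegrable (fun z => Real.log ‖h z‖) 0 1 :=
      MeromorphicOn.circleIntegrable_log_norm (by
        rw [abs_one]
        exact (hh.mono Metric.sphere_subset_closedBall).meromorphicOn)
    have h2 := (intervalIntegrable_iff_integrableOn_Ioc_of_le hpi.le).1 this
    exact h2.neg
  -- Jensen's formula; the zeros in the closed disc contribute nonnegative terms.
  have hjen : Real.log ‖h 0‖ ≤ (2 * Real.pi)⁻¹ * ∫ θ in s, Real.log ‖h (circleMap 0 1 θ)‖ := by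
    have hJ := AnalyticOnNhd.circleAverage_log_norm (c := (0 : ℂ)) one_ne_zero
      (by rwa [abs_one]) h0
    rw [Real.circleAverage, intervalIntegral.integral_of_le hpi.le, smul_eq_mul] at hJ
    rw [hJ]
    refine le_add_of_nonneg_left (finsum_nonneg fun u => ?_)
    by_cases hu : u ∈ Metric.closedBall (0 : ℂ) |1|
    · refine mul_nonneg ?_ ?_
      · have := MeromorphicOn.AnalyticOnNhd.divisor_nonneg
          (show AnalyticOnNhd ℂ h (Metric.closedBall 0 |1|) by rwa [abs_one])
        exact_mod_cast this u
      · by_cases hu0 : u = 0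
        · simp [hu0]
        rw [one_mul, zero_sub, norm_neg]
        refine Real.log_nonneg ((one_le_inv₀ (norm_pos_iff.2 hu0)).2 ?_)
        simpa using hu
    · have : MeromorphicOn.divisor h (Metric.closedBall (0 : ℂ) |1|) u = 0 :=
        Function.locallyFinsuppWithin.apply_eq_zero_of_notMem _ hu
      simp [this]
  have hpos : (⨍⁻ θ in s, (ENNReal.log ‖h (circleMap 0 1 θ)‖ₑ).toENNReal ∂volume) = 0 := by
    have : ∀ θ, (ENNReal.log ‖h (circleMap 0 1 θ)‖ₑ).toENNReal = 0 := fun θ =>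
      EReal.toENNReal_of_nonpos (log_enorm_nonpos (h1 _ (hcirc θ)))
    simp only [this, laverage_zero]
  have hneg : (⨍⁻ θ in s, (-ENNReal.log ‖h (circleMap 0 1 θ)‖ₑ).toENNReal ∂volume) =
      ENNReal.ofReal ((2 * Real.pi)⁻¹ * ∫ θ in s, -Real.log ‖h (circleMap 0 1 θ)‖) := by
    rw [setLAverage_eq, lintegral_congr_ae (g := fun θ =>
      ENNReal.ofReal (-Real.log ‖h (circleMap 0 1 θ)‖)),
      ← ofReal_integral_eq_lintegral_ofReal hint, ENNReal.ofReal_mul (by positivity),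
      ENNReal.div_eq_inv_mul, hs, Real.volume_Ioc, sub_zero, ENNReal.ofReal_inv_of_pos hpi]
    · filter_upwards with θ
      simpa using Real.log_nonpos (norm_nonneg _) (h1 _ (hcirc θ))
    · filter_upwards [hne] with θ hθ
      rw [log_enorm_of_ne_zero hθ, ← EReal.coe_neg, EReal.real_coe_toENNReal]
  rw [angularMean, hpos, hneg, log_enorm_of_ne_zero h0, integral_neg, mul_neg]
  rw [EReal.coe_ennreal_zero, zero_sub, EReal.le_neg, ← EReal.coe_neg, EReal.coe_ennreal_ofReal,
    EReal.coe_le_coe_iff, max_le_iff]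
  constructor
  · linarith
  · exact neg_nonneg.2 (Real.log_nonpos (norm_nonneg _) (h1 0 (by simp)))

variable {n : ℕ}

/-- Jensen's formula on discs gives plurisubharmonicity, and `φ z = O(z - w)` gives the logarithmic
pole. -/
theorem log_enorm_mem_greenFamily {Ω : Set (EuclideanSpace ℂ (Fin n))}
    {w : EuclideanSpace ℂ (Fin n)} (hΩ : IsOpen Ω) (hw : w ∈ Ω)
    {φ : EuclideanSpace ℂ (Fin n) → ℂ} (hφ : DifferentiableOn ℂ φ Ω)
    (hmap : ∀ z ∈ Ω, ‖φ z‖ < 1) (h0 : φ w = 0) :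
    (fun z => ENNReal.log ‖φ z‖ₑ) ∈ greenFamily Ω w := by
  refine ⟨⟨?_, ?_, ?_⟩, fun z hz => log_enorm_nonpos (hmap z hz).le, ?_⟩
  · intro z hz
    exact (log_enorm_nonpos (hmap z hz).le).trans_lt EReal.zero_lt_top
  · exact (ENNReal.continuous_log.comp_continuousOn hφ.continuousOn.enorm).upperSemicontinuousOn
  · intro a X hX
    have hline : Continuous fun ζ : ℂ => a + ζ • X := by fun_prop
    have hU : IsOpen {ζ : ℂ | a + ζ • X ∈ Ω} := hΩ.preimage hline
    have hd : DifferentiableOn ℂ (fun ζ : ℂ => φ (a + ζ • X)) {ζ : ℂ | a + ζ • X ∈ Ω} :=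
      hφ.comp (by fun_prop) fun ζ hζ => hζ
    have := log_enorm_le_angularMean (h := fun ζ : ℂ => φ (a + ζ • X))
      (fun ζ hζ => hd.analyticAt (hU.mem_nhds (hX ζ (by simpa using hζ))))
      (fun ζ hζ => (hmap _ (hX ζ (by simpa using hζ))).le)
    simpa using this
  · have hO := (hφ.differentiableAt (hΩ.mem_nhds hw)).isBigO_sub
    obtain ⟨C, hC, hb⟩ := hO.exists_pos
    refine ⟨Real.log C, ?_⟩
    filter_upwards [hb.bound] with z hz
    rw [h0, sub_zero] at hz
    have e : (Real.log C : EReal) = ENNReal.log (ENNReal.ofReal C) := by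
      rw [ENNReal.log_pos_real (by simpa using hC) (by simp), ENNReal.toReal_ofReal hC.le]
    rw [e, ← ENNReal.log_mul_add]
    refine ENNReal.log_monotone ?_
    rw [← ofReal_norm, ← ofReal_norm, ← ENNReal.ofReal_mul (norm_nonneg _)]
    exact ENNReal.ofReal_le_ofReal (by rwa [mul_comm])

/-- The Carathéodory metric is at most the Azukawa metric. -/
theorem log_enorm_fderiv_le_limsup {Ω : Set (EuclideanSpace ℂ (Fin n))}
    {w : EuclideanSpace ℂ (Fin n)} (hΩ : IsOpen Ω) (hw : w ∈ Ω)
    {φ : EuclideanSpace ℂ (Fin n) → ℂ} (hφ : DifferentiableOn ℂ φ Ω)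
    (hmap : ∀ z ∈ Ω, ‖φ z‖ < 1) (h0 : φ w = 0) (X : EuclideanSpace ℂ (Fin n)) :
    ENNReal.log ‖fderiv ℂ φ w X‖ₑ ≤
      limsup (fun ζ : ℂ => pluricomplexGreen Ω w (w + ζ • X) - (Real.log ‖ζ‖ : EReal))
        (𝓝[≠] (0 : ℂ)) := by
  have hd : HasDerivAt (fun ζ : ℂ => φ (w + ζ • X)) (fderiv ℂ φ w X) 0 := by
    have h1 : HasDerivAt (fun ζ : ℂ => w + ζ • X) X 0 := by
      simpa using ((hasDerivAt_id (0 : ℂ)).smul_const X).const_add w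
    have h2 : HasFDerivAt φ (fderiv ℂ φ w) (w + (0 : ℂ) • X) := by
      simpa using (hφ.differentiableAt (hΩ.mem_nhds hw)).hasFDerivAt
    exact h2.comp_hasDerivAt (0 : ℂ) h1
  -- Because `φ w = 0`, subtracting `log |ζ|` from `log |φ(w + ζX)|` leaves the logarithm of this
  -- difference quotient.
  have hlim : Tendsto (fun ζ : ℂ => ENNReal.log ‖slope (fun ζ : ℂ => φ (w + ζ • X)) 0 ζ‖ₑ)
      (𝓝[≠] (0 : ℂ)) (𝓝 (ENNReal.log ‖fderiv ℂ φ w X‖ₑ)) :=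
    (ENNReal.continuous_log.tendsto _).comp
      ((continuous_enorm.tendsto _).comp (hasDerivAt_iff_tendsto_slope.1 hd))
  rw [← hlim.limsup_eq]
  refine limsup_le_limsup ?_
  filter_upwards [self_mem_nhdsWithin] with ζ hζ
  have hζ0 : ζ ≠ 0 := hζ
  have hG : ENNReal.log ‖φ (w + ζ • X)‖ₑ ≤ pluricomplexGreen Ω w (w + ζ • X) :=
    le_iSup₂_of_le (fun z => ENNReal.log ‖φ z‖ₑ)
      (log_enorm_mem_greenFamily hΩ hw hφ hmap h0) le_rfl
  rw [EReal.le_sub_iff_add_le (by simp) (by simp)]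
  refine le_trans (le_of_eq ?_) hG
  rw [← log_enorm_of_ne_zero hζ0, ← ENNReal.log_mul_add, ← enorm_mul, slope_def_field]
  simp [h0, hζ0]

/-- If maps of `Ω` into the disc have derivatives at `w` in the direction `X` of modulus at least
any `r < 1`, then `X` is not in the Azukawa indicatrix. -/
theorem notMem_azukawaIndicatrix {Ω : Set (EuclideanSpace ℂ (Fin n))}
    {w X : EuclideanSpace ℂ (Fin n)} (hΩ : IsOpen Ω) (hw : w ∈ Ω)
    (h : ∀ r : ℝ, 0 < r → r < 1 → ∃ φ : EuclideanSpace ℂ (Fin n) → ℂ, DifferentiableOn ℂ φ Ω ∧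
      (∀ z ∈ Ω, ‖φ z‖ < 1) ∧ φ w = 0 ∧ r ≤ ‖fderiv ℂ φ w X‖) :
    X ∉ azukawaIndicatrix Ω w := by
  intro hX
  refine absurd (lt_of_le_of_lt ?_ hX) (lt_irrefl (0 : EReal))
  have hlim : Tendsto (fun r : ℝ => ENNReal.log (ENNReal.ofReal r)) (𝓝[<] 1) (𝓝 0) := by
    have : Tendsto (fun r : ℝ => ENNReal.log (ENNReal.ofReal r)) (𝓝 1)
        (𝓝 (ENNReal.log (ENNReal.ofReal 1))) :=
      (ENNReal.continuous_log.comp ENNReal.continuous_ofReal).tendsto 1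
    simp only [ENNReal.ofReal_one, ENNReal.log_one] at this
    exact this.mono_left nhdsWithin_le_nhds
  refine le_of_tendsto hlim ?_
  filter_upwards [Ioo_mem_nhdsLT zero_lt_one] with r hr
  obtain ⟨φ, hφ, hmap, h0, hle⟩ := h r hr.1 hr.2
  refine le_trans (ENNReal.log_monotone ?_) (log_enorm_fderiv_le_limsup hΩ hw hφ hmap h0 X)
  rw [← ofReal_norm]
  exact ENNReal.ofReal_le_ofReal hle

/-! ### The Bergman kernel and the balanced part. -/

theorem measurePreserving_smul_of_norm_eq_one {c : ℂ} (hc : ‖c‖ = 1) :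
    MeasurePreserving (fun x : EuclideanSpace ℂ (Fin n) => c • x) volume volume := by
  have hc0 : c ≠ 0 := by
    rintro rfl
    simp at hc
  let e : EuclideanSpace ℂ (Fin n) ≃ₗᵢ[ℝ] EuclideanSpace ℂ (Fin n) :=
    LinearIsometryEquiv.mk ((LinearEquiv.smulOfNeZero ℂ _ c hc0).restrictScalars ℝ)
      fun x => by simp [norm_smul, hc]
  exact e.measurePreserving

/-- The largest subset of `Ω - w` that is balanced about the origin. -/
def balancedPart (Ω : Set (EuclideanSpace ℂ (Fin n))) (w : EuclideanSpace ℂ (Fin n)) :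
    Set (EuclideanSpace ℂ (Fin n)) :=
  {X | ∀ η : ℂ, ‖η‖ ≤ 1 → w + η • X ∈ Ω}

theorem isOpen_balancedPart {Ω : Set (EuclideanSpace ℂ (Fin n))} (hΩ : IsOpen Ω)
    (w : EuclideanSpace ℂ (Fin n)) : IsOpen (balancedPart Ω w) := by
  rw [isOpen_iff_mem_nhds]
  intro X hX
  have h := (isCompact_closedBall (0 : ℂ) 1).eventually_forall_of_forall_eventually
    (x₀ := X) (P := fun Y η => w + η • Y ∈ Ω) fun η hη => by
      have hc : Continuous fun p : EuclideanSpace ℂ (Fin n) × ℂ => w + p.2 • p.1 := by fun_prop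
      exact hc.continuousAt.eventually_mem (hΩ.mem_nhds (hX η (by simpa using hη)))
  filter_upwards [h] with Y hY η hη
  exact hY η (by simpa using hη)

theorem smul_mem_balancedPart_iff {Ω : Set (EuclideanSpace ℂ (Fin n))}
    {w X : EuclideanSpace ℂ (Fin n)} {c : ℂ} (hc : ‖c‖ = 1) :
    c • X ∈ balancedPart Ω w ↔ X ∈ balancedPart Ω w := by
  have key : ∀ (c : ℂ) (X : EuclideanSpace ℂ (Fin n)), ‖c‖ = 1 → X ∈ balancedPart Ω w →
      c • X ∈ balancedPart Ω w := by
    intro c X hc hX η hη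
    rw [smul_smul]
    exact hX _ (by rw [norm_mul, hc, mul_one]; exact hη)
  refine ⟨fun h => ?_, key c X hc⟩
  have := key c⁻¹ _ (by simp [hc]) h
  rwa [smul_smul, inv_mul_cancel₀ (by rintro rfl; simp at hc), one_smul] at this

/-- The sub-mean value inequality for `|h|²`. -/
theorem two_pi_mul_enorm_sq_le {h : ℂ → ℂ} (hh : DifferentiableOn ℂ h (Metric.closedBall 0 1)) :
    ENNReal.ofReal (2 * Real.pi) * ‖h 0‖ₑ ^ 2 ≤
      ∫⁻ θ in Ioc 0 (2 * Real.pi), ‖h (circleMap 0 1 θ)‖ₑ ^ 2 := by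
  have hmean : Real.circleAverage (fun z => h z ^ 2) 0 1 = h 0 ^ 2 := by
    refine DiffContOnCl.circleAverage ?_
    rw [abs_one]
    exact (hh.pow 2).diffContOnCl_ball subset_rfl
  have hpi : 0 < 2 * Real.pi := Real.two_pi_pos
  rw [Real.circleAverage, intervalIntegral.integral_of_le hpi.le] at hmean
  have : ‖h 0‖ₑ ^ 2 = ENNReal.ofReal (2 * Real.pi)⁻¹ *
      ‖∫ θ in Ioc 0 (2 * Real.pi), h (circleMap 0 1 θ) ^ 2‖ₑ := by
    rw [← enorm_pow, ← hmean, enorm_smul, Real.enorm_of_nonneg (by positivity)]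
  rw [this, ← mul_assoc, ← ENNReal.ofReal_mul hpi.le, mul_inv_cancel₀ hpi.ne', ENNReal.ofReal_one,
    one_mul]
  refine (enorm_integral_le_lintegral_enorm _).trans_eq ?_
  simp only [enorm_pow]

/-- For each `X` in the balanced part, `|f(w)|²` is at most the mean of `|f|²` over the circle
through `w + X`. Integrating in `X` and exchanging integrals, rotation invariance turns the right
side into the integral of `|f|²` over the translated balanced part, at most one. -/
theorem bergmanKernel_mul_volume_le {Ω : Set (EuclideanSpace ℂ (Fin n))} (hΩ : IsOpen Ω)
    (w : EuclideanSpace ℂ (Fin n)) : bergmanKernel Ω w * volume (balancedPart Ω w) ≤ 1 := by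
  simp only [bergmanKernel, ENNReal.iSup_mul]
  refine iSup_le fun f => iSup_le fun hf => iSup_le fun hint => ?_
  set B := balancedPart Ω w with hB
  have hBo : IsOpen B := isOpen_balancedPart hΩ w
  have hBm : MeasurableSet B := hBo.measurableSet
  have hpi : 0 < 2 * Real.pi := Real.two_pi_pos
  set g : EuclideanSpace ℂ (Fin n) → ℝ≥0∞ := fun X => ‖f (w + X)‖ₑ ^ 2 with hg
  have hBint : ∫⁻ X in B, g X ≤ 1 := by
    refine le_trans ?_ hint
    have hmp : MeasurePreserving (fun X : EuclideanSpace ℂ (Fin n) => w + X) volume volume :=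
      measurePreserving_add_left volume w
    have hemb : MeasurableEmbedding fun X : EuclideanSpace ℂ (Fin n) => w + X :=
      (MeasurableEquiv.addLeft w).measurableEmbedding
    rw [← hmp.setLIntegral_comp_preimage_emb hemb (fun z => ‖f z‖ₑ ^ 2) Ω]
    refine lintegral_mono_set fun X hX => ?_
    simpa using hX 1 (by simp)
  have hrot : ∀ θ : ℝ, ∫⁻ X in B, g (circleMap 0 1 θ • X) = ∫⁻ X in B, g X := by
    intro θ
    have hc : ‖circleMap 0 1 θ‖ = 1 := by simp
    have hc0 : circleMap 0 1 θ ≠ 0 := circleMap_ne_center one_ne_zero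
    have hemb : MeasurableEmbedding fun X : EuclideanSpace ℂ (Fin n) => circleMap 0 1 θ • X :=
      (Homeomorph.smulOfNeZero _ hc0).measurableEmbedding
    have := (measurePreserving_smul_of_norm_eq_one hc).setLIntegral_comp_preimage_emb hemb g B
    rw [← this]
    congr 2
    ext X
    exact (smul_mem_balancedPart_iff hc).symm
  have hsub : ∀ X ∈ B, ENNReal.ofReal (2 * Real.pi) * ‖f w‖ₑ ^ 2 ≤
      ∫⁻ θ in Ioc 0 (2 * Real.pi), g (circleMap 0 1 θ • X) := by
    intro X hX
    have hd : DifferentiableOn ℂ (fun ζ : ℂ => f (w + ζ • X)) (Metric.closedBall 0 1) :=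
      hf.comp (by fun_prop) fun ζ hζ => hX ζ (by simpa using hζ)
    simpa [hg] using two_pi_mul_enorm_sq_le hd
  have hmeas : AEMeasurable (fun p : EuclideanSpace ℂ (Fin n) × ℝ => g (circleMap 0 1 p.2 • p.1))
      ((volume.restrict B).prod (volume.restrict (Ioc 0 (2 * Real.pi)))) := by
    have hcont : ContinuousOn
        (fun p : EuclideanSpace ℂ (Fin n) × ℝ => g (circleMap 0 1 p.2 • p.1)) (B ×ˢ univ) := by
      have h1 : ContinuousOn (fun p : EuclideanSpace ℂ (Fin n) × ℝ =>
          f (w + circleMap 0 1 p.2 • p.1)) (B ×ˢ univ) := by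
        refine hf.continuousOn.comp ?_ fun p hp => hp.1 _ (by simp)
        have : Continuous (circleMap 0 1) := continuous_circleMap 0 1
        fun_prop
      exact (ENNReal.continuous_pow 2).comp_continuousOn h1.enorm
    have h2 := hcont.aemeasurable
      (μ := (volume : Measure (EuclideanSpace ℂ (Fin n))).prod (volume : Measure ℝ))
      (hBm.prod MeasurableSet.univ)
    rw [Measure.prod_restrict]
    exact h2.mono_measure (Measure.restrict_mono (prod_mono_right (subset_univ _)) le_rfl)
  have hmain : ENNReal.ofReal (2 * Real.pi) * (‖f w‖ₑ ^ 2 * volume B) ≤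
      ENNReal.ofReal (2 * Real.pi) * 1 := by
    calc ENNReal.ofReal (2 * Real.pi) * (‖f w‖ₑ ^ 2 * volume B)
        = ∫⁻ X in B, ENNReal.ofReal (2 * Real.pi) * ‖f w‖ₑ ^ 2 := by
          rw [setLIntegral_const, mul_assoc]
      _ ≤ ∫⁻ X in B, ∫⁻ θ in Ioc 0 (2 * Real.pi), g (circleMap 0 1 θ • X) :=
          setLIntegral_mono' hBm hsub
      _ = ∫⁻ θ in Ioc 0 (2 * Real.pi), ∫⁻ X in B, g (circleMap 0 1 θ • X) :=
          lintegral_lintegral_swap hmeas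
      _ = ∫⁻ θ in Ioc 0 (2 * Real.pi), ∫⁻ X in B, g X := by simp only [hrot]
      _ = (∫⁻ X in B, g X) * ENNReal.ofReal (2 * Real.pi) := by
          rw [setLIntegral_const, Real.volume_Ioc, sub_zero]
      _ ≤ ENNReal.ofReal (2 * Real.pi) * 1 := by
          rw [mul_comm]
          gcongr
  exact (ENNReal.mul_le_mul_iff_right (by simpa using hpi) ENNReal.ofReal_ne_top).1 hmain

open scoped Pointwise in
/-- If the Azukawa indicatrix is contained in the `c`-fold multiple of the balanced part of
`Ω - w`, then the Bergman kernel satisfies the upper estimate with the constant `c²`. -/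
theorem bergmanKernel_le_of_subset {Ω : Set (EuclideanSpace ℂ (Fin n))} (hΩ : IsOpen Ω)
    {w : EuclideanSpace ℂ (Fin n)} {c : ℝ} (hc : 0 < c)
    (h : ∀ X ∈ azukawaIndicatrix Ω w, c⁻¹ • X ∈ balancedPart Ω w) :
    bergmanKernel Ω w ≤ ENNReal.ofReal (c ^ 2) ^ n / volume (azukawaIndicatrix Ω w) := by
  have hpos : 0 < ENNReal.ofReal (c ^ 2) ^ n :=
    ENNReal.pow_pos (by simpa using pow_pos hc 2) n
  rw [ENNReal.le_div_iff_mul_le (Or.inr hpos.ne') (Or.inr (ENNReal.pow_ne_top ENNReal.ofReal_ne_top))]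
  have hsub : azukawaIndicatrix Ω w ⊆ c • balancedPart Ω w := fun X hX =>
    (mem_smul_set_iff_inv_smul_mem₀ hc.ne' _ _).2 (h X hX)
  have hvol : volume (azukawaIndicatrix Ω w) ≤
      ENNReal.ofReal (c ^ 2) ^ n * volume (balancedPart Ω w) := by
    refine (measure_mono hsub).trans_eq ?_
    rw [Measure.addHaar_smul, finrank_real_of_complex, finrank_euclideanSpace_fin,
      abs_of_pos (by positivity), ← ENNReal.ofReal_pow (by positivity), ← pow_mul]
  calc bergmanKernel Ω w * volume (azukawaIndicatrix Ω w)
      ≤ bergmanKernel Ω w * (ENNReal.ofReal (c ^ 2) ^ n * volume (balancedPart Ω w)) := by gcongr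
    _ = ENNReal.ofReal (c ^ 2) ^ n * (bergmanKernel Ω w * volume (balancedPart Ω w)) := by ring
    _ ≤ ENNReal.ofReal (c ^ 2) ^ n * 1 := by
        gcongr
        exact bergmanKernel_mul_volume_le hΩ w
    _ = ENNReal.ofReal (c ^ 2) ^ n := mul_one _

/-! ### Reduction to planar domains, and the two convex cases. -/

theorem fderiv_comp_clm_sub {E : Type*} [NormedAddCommGroup E] [NormedSpace ℂ E] (ξ : E →L[ℂ] ℂ)
    (w X : E) {ψ : ℂ → ℂ} {d : ℂ} (hψ : HasDerivAt ψ d 0) :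
    fderiv ℂ (fun z => ψ (ξ (z - w))) w X = d * ξ X := by
  have h1 : HasFDerivAt (fun z => ξ (z - w)) ξ w :=
    ξ.hasFDerivAt.comp w ((hasFDerivAt_id w).sub_const w)
  have h2 : HasDerivAt ψ d (ξ (w - w)) := by simpa using hψ
  have h3 := HasDerivAt.comp_hasFDerivAt w h2 h1
  have h4 : HasFDerivAt (fun z => ψ (ξ (z - w))) (d • ξ) w := h3
  rw [h4.fderiv]
  simp

theorem notMem_azukawaIndicatrix_of_clm {Ω : Set (EuclideanSpace ℂ (Fin n))}
    {w X : EuclideanSpace ℂ (Fin n)} (hΩ : IsOpen Ω) (hw : w ∈ Ω)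
    (ξ : EuclideanSpace ℂ (Fin n) →L[ℂ] ℂ) {D : Set ℂ} (hD : IsOpen D)
    (hmap : ∀ z ∈ Ω, ξ (z - w) ∈ D)
    (h : ∀ r : ℝ, 0 < r → r < 1 → ∃ ψ : ℂ → ℂ, DifferentiableOn ℂ ψ D ∧
      (∀ z ∈ D, ‖ψ z‖ < 1) ∧ ψ 0 = 0 ∧ r ≤ ‖deriv ψ 0‖ * ‖ξ X‖) :
    X ∉ azukawaIndicatrix Ω w := by
  refine notMem_azukawaIndicatrix hΩ hw fun r hr0 hr1 => ?_
  obtain ⟨ψ, hψ, hψ1, hψ0, hr⟩ := h r hr0 hr1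
  have h0D : (0 : ℂ) ∈ D := by simpa using hmap w hw
  refine ⟨fun z => ψ (ξ (z - w)), hψ.comp (by fun_prop) hmap, fun z hz => hψ1 _ (hmap z hz),
    by simp [hψ0], ?_⟩
  rw [fderiv_comp_clm_sub ξ w X (hψ.differentiableAt (hD.mem_nhds h0D)).hasDerivAt, norm_mul]
  exact hr

/-- Hahn-Banach, normalised by a positive real factor; positivity comes from `w ∈ Ω`. -/
theorem exists_supporting_clm {E : Type*} [NormedAddCommGroup E] [NormedSpace ℂ E] {Ω : Set E}
    (hΩ : IsOpen Ω) (hconv : Convex ℝ Ω) {w v : E} (hw : w ∈ Ω) (hv : w + v ∉ Ω) :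
    ∃ ξ : E →L[ℂ] ℂ, (∀ z ∈ Ω, (ξ (z - w)).re < 1) ∧ (ξ v).re = 1 := by
  obtain ⟨l, hl⟩ := RCLike.geometric_hahn_banach_open_point (𝕜 := ℂ) hconv hΩ hv
  set c := (l v).re with hc
  have hlt : ∀ z ∈ Ω, (l (z - w)).re < c := by
    intro z hz
    have := hl z hz
    simp only [RCLike.re_eq_complex_re, map_add] at this
    rw [map_sub, Complex.sub_re]
    linarith
  have hcpos : 0 < c := by simpa using hlt w hw
  have hre : ∀ x, (((c⁻¹ : ℝ) : ℂ) • l x).re = c⁻¹ * (l x).re := fun x => by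
    rw [smul_eq_mul, Complex.re_ofReal_mul]
  refine ⟨((c⁻¹ : ℝ) : ℂ) • l, fun z hz => ?_, ?_⟩
  · rw [smul_apply, hre, inv_mul_lt_one₀ hcpos]
    exact hlt z hz
  · rw [smul_apply, hre, ← hc, inv_mul_cancel₀ hcpos.ne']

theorem norm_clm_ge_of_re_eq_one {E : Type*} [NormedAddCommGroup E] [NormedSpace ℂ E]
    (ξ : E →L[ℂ] ℂ) {X : E} {η : ℂ} {c : ℝ} (hη : ‖η‖ ≤ 1) (hc : 0 < c)
    (h : (ξ (η • c⁻¹ • X)).re = 1) : c ≤ ‖ξ X‖ := by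
  have h1 : 1 ≤ ‖ξ (η • c⁻¹ • X)‖ := by
    rw [← h]
    exact Complex.re_le_norm _
  rw [map_smul, ξ.map_smul_of_tower, norm_smul, norm_smul, Real.norm_of_nonneg (by positivity)] at h1
  have h2 : ‖η‖ * (c⁻¹ * ‖ξ X‖) ≤ c⁻¹ * ‖ξ X‖ := mul_le_of_le_one_left (by positivity) hη
  have h3 := h1.trans h2
  rwa [inv_mul_eq_div, one_le_div hc] at h3

theorem norm_lt_norm_two_sub {z : ℂ} (hz : z.re < 1) : ‖z‖ < ‖2 - z‖ := by
  rw [← sq_lt_sq₀ (norm_nonneg _) (norm_nonneg _), ← Complex.normSq_eq_norm_sq,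
    ← Complex.normSq_eq_norm_sq, Complex.normSq_apply, Complex.normSq_apply]
  simp
  nlinarith

theorem norm_sub_one_lt_norm_add_one {q : ℂ} (hq : 0 < q.re) : ‖q - 1‖ < ‖q + 1‖ := by
  rw [← sq_lt_sq₀ (norm_nonneg _) (norm_nonneg _), ← Complex.normSq_eq_norm_sq,
    ← Complex.normSq_eq_norm_sq, Complex.normSq_apply, Complex.normSq_apply]
  simp
  nlinarith

/-- The supporting form sends `Ω` to the half-plane `Re z < 1`, which `z / (2 - z)` maps into the
disc with derivative `1/2` at `0`; the factor `|ξ X| ≥ 2` compensates. -/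
theorem half_smul_mem_balancedPart_of_convex {Ω : Set (EuclideanSpace ℂ (Fin n))}
    {w : EuclideanSpace ℂ (Fin n)} (hΩ : IsOpen Ω) (hconv : Convex ℝ Ω) (hw : w ∈ Ω)
    {X : EuclideanSpace ℂ (Fin n)} (hX : X ∈ azukawaIndicatrix Ω w) :
    (2 : ℝ)⁻¹ • X ∈ balancedPart Ω w := by
  intro η hη
  by_contra hn
  obtain ⟨ξ, hξ, hξ1⟩ := exists_supporting_clm hΩ hconv hw hn
  have hle := norm_clm_ge_of_re_eq_one ξ hη two_pos hξ1
  have hne : ∀ z : ℂ, z.re < 1 → 2 - z ≠ 0 := fun z hz h => by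
    have := norm_lt_norm_two_sub hz
    rw [h, norm_zero] at this
    exact (norm_nonneg z).not_gt this
  have hder : ∀ z : ℂ, z.re < 1 →
      HasDerivAt (fun z : ℂ => z / (2 - z)) ((1 * (2 - z) - z * (-1)) / (2 - z) ^ 2) z :=
    fun z hz => (hasDerivAt_id z).div ((hasDerivAt_id z).const_sub 2) (hne z hz)
  refine notMem_azukawaIndicatrix_of_clm (X := X) hΩ hw ξ (D := {z | z.re < 1})
    (isOpen_lt Complex.continuous_re continuous_const) hξ (fun r hr0 hr1 =>
      ⟨fun z => z / (2 - z), fun z hz => (hder z hz).differentiableAt.differentiableWithinAt,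
        fun z hz => ?_, by simp, ?_⟩) hX
  · rw [norm_div, div_lt_one (norm_pos_iff.2 (hne z hz))]
    exact norm_lt_norm_two_sub hz
  · rw [(hder 0 (by simp)).deriv]
    norm_num
    linarith

/-- Symmetry improves the half-plane to the strip `|Re z| < 1`. The exponential `q` sends it to the
right half-plane, and the Cayley transform follows; the derivative at `0` has modulus `π/4`. -/
theorem pi_div_four_smul_mem_balancedPart_of_symmetric {Ω : Set (EuclideanSpace ℂ (Fin n))}
    {w : EuclideanSpace ℂ (Fin n)} (hΩ : IsOpen Ω) (hconv : Convex ℝ Ω) (hw : w ∈ Ω)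
    (hsymm : ∀ v : EuclideanSpace ℂ (Fin n), w + v ∈ Ω → w - v ∈ Ω)
    {X : EuclideanSpace ℂ (Fin n)} (hX : X ∈ azukawaIndicatrix Ω w) :
    (4 / Real.pi : ℝ)⁻¹ • X ∈ balancedPart Ω w := by
  have hpi := Real.pi_pos
  intro η hη
  by_contra hn
  obtain ⟨ξ, hξ, hξ1⟩ := exists_supporting_clm hΩ hconv hw hn
  have hle := norm_clm_ge_of_re_eq_one ξ hη (by positivity) hξ1
  have hξ2 : ∀ z ∈ Ω, |(ξ (z - w)).re| < 1 := by
    intro z hz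
    rw [abs_lt]
    refine ⟨?_, hξ z hz⟩
    have h1 := hξ _ (hsymm (z - w) (by simpa using hz))
    rw [show w - (z - w) - w = -(z - w) by abel, map_neg, Complex.neg_re] at h1
    linarith
  set q : ℂ → ℂ := fun z => Complex.exp (Real.pi / 2 * Complex.I * z) with hq
  have hqre : ∀ z : ℂ, |z.re| < 1 → 0 < (q z).re := by
    intro z hz
    rw [hq, Complex.exp_re]
    refine mul_pos (Real.exp_pos _) (Real.cos_pos_of_mem_Ioo ?_)
    have e : (Real.pi / 2 * Complex.I * z : ℂ).im = Real.pi / 2 * z.re := by simp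
    rw [e]
    have := abs_lt.1 hz
    constructor <;> nlinarith
  have hne : ∀ z : ℂ, |z.re| < 1 → q z + 1 ≠ 0 := fun z hz h => by
    have := norm_sub_one_lt_norm_add_one (hqre z hz)
    rw [h, norm_zero] at this
    exact (norm_nonneg _).not_gt this
  have hqd : ∀ z, HasDerivAt q (q z * (Real.pi / 2 * Complex.I)) z := fun z => by
    have : HasDerivAt (fun z : ℂ => Real.pi / 2 * Complex.I * z) (Real.pi / 2 * Complex.I) z := by
      simpa using (hasDerivAt_id z).const_mul (Real.pi / 2 * Complex.I : ℂ)
    exact this.cexp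
  have hder : ∀ z : ℂ, |z.re| < 1 → HasDerivAt (fun z : ℂ => (q z - 1) / (q z + 1))
      ((q z * (Real.pi / 2 * Complex.I) * (q z + 1) -
        (q z - 1) * (q z * (Real.pi / 2 * Complex.I))) / (q z + 1) ^ 2) z :=
    fun z hz => ((hqd z).sub_const 1).div ((hqd z).add_const 1) (hne z hz)
  have hq0 : q 0 = 1 := by simp [hq]
  refine notMem_azukawaIndicatrix_of_clm (X := X) hΩ hw ξ (D := {z | |z.re| < 1})
    (isOpen_lt Complex.continuous_re.abs continuous_const) hξ2 (fun r hr0 hr1 =>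
      ⟨fun z => (q z - 1) / (q z + 1),
        fun z hz => (hder z hz).differentiableAt.differentiableWithinAt,
        fun z hz => ?_, by simp [hq0], ?_⟩) hX
  · rw [norm_div, div_lt_one (norm_pos_iff.2 (hne z hz))]
    exact norm_sub_one_lt_norm_add_one (hqre z hz)
  · rw [(hder 0 (by simp)).deriv, hq0]
    have e : ‖((1 * (Real.pi / 2 * Complex.I) * (1 + 1) -
        (1 - 1) * (1 * (Real.pi / 2 * Complex.I))) / (1 + 1) ^ 2 : ℂ)‖ = Real.pi / 4 := by
      have : ((1 * (Real.pi / 2 * Complex.I) * (1 + 1) -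
        (1 - 1) * (1 * (Real.pi / 2 * Complex.I))) / (1 + 1) ^ 2 : ℂ) =
          ((Real.pi / 4 : ℝ) : ℂ) * Complex.I := by
        push_cast
        ring
      rw [this, norm_mul, Complex.norm_I, mul_one, Complex.norm_real,
        Real.norm_of_nonneg (by positivity)]
    rw [e]
    calc r ≤ 1 := hr1.le
      _ = Real.pi / 4 * (4 / Real.pi) := by field_simp
      _ ≤ _ := by gcongr

/-! ### Logarithms on families of planar sets. -/

/-- The exponential is a covering map, so a continuous lift of a constant on a preconnected set is
constant. -/
theorem IsPreconnected.sub_eq_of_exp_eq {X : Type*} [TopologicalSpace X] {S : Set X}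
    (hS : IsPreconnected S) {g₁ g₂ : X → ℂ} (h₁ : ContinuousOn g₁ S) (h₂ : ContinuousOn g₂ S)
    (h : ∀ x ∈ S, ∀ y ∈ S, Complex.exp (g₁ x - g₂ x) = Complex.exp (g₁ y - g₂ y)) {x y : X}
    (hx : x ∈ S) (hy : y ∈ S) : g₁ x - g₂ x = g₁ y - g₂ y :=
  Complex.isCoveringMap_exp.constOn_of_comp (g := fun x => g₁ x - g₂ x) hS (h₁.sub h₂)
    (fun a ha b hb => Subtype.ext (h a ha b hb)) hx hy

/-- Joint continuity of fibrewise continuous logarithms. -/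
theorem continuousAt_fibrewise_log {X : Type*} [TopologicalSpace X] {E : Set (X × ℂ)}
    (hE : IsOpen E) {f ℓ : X × ℂ → ℂ} (hf : ContinuousOn f E)
    (hexp : ∀ p ∈ E, Complex.exp (ℓ p) = f p)
    (hfib : ∀ x, ContinuousOn (fun ζ => ℓ (x, ζ)) {ζ | (x, ζ) ∈ E}) {x₀ : X}
    (hpre : IsPreconnected {ζ | (x₀, ζ) ∈ E}) {a : ℂ} (ha : (x₀, a) ∈ E)
    (hca : ContinuousAt (fun x => ℓ (x, a)) x₀) {y : ℂ} (hy : (x₀, y) ∈ E) :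
    ContinuousAt ℓ (x₀, y) := by
  have key : ∀ y, (x₀, y) ∈ E → ∃ δ > 0, Metric.ball y δ ⊆ {ζ | (x₀, ζ) ∈ E} ∧
      ∀ y₁ ∈ Metric.ball y δ, ContinuousAt (fun x => ℓ (x, y₁)) x₀ →
        ∀ y₂ ∈ Metric.ball y δ, ContinuousAt ℓ (x₀, y₂) := by
    intro y hy
    have hfy : f (x₀, y) ≠ 0 := by
      rw [← hexp _ hy]
      exact Complex.exp_ne_zero _
    have hEy : E ∈ 𝓝 (x₀, y) := hE.mem_nhds hy
    have hslit : ∀ᶠ p in 𝓝 (x₀, y), p ∈ E ∧ f p / f (x₀, y) ∈ Complex.slitPlane := by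
      refine Filter.Eventually.and hEy ?_
      have h1 : ContinuousAt (fun p => f p / f (x₀, y)) (x₀, y) :=
        (hf.continuousAt hEy).div_const _
      refine h1.eventually_mem (Complex.isOpen_slitPlane.mem_nhds ?_)
      rw [div_self hfy]
      exact Complex.one_mem_slitPlane
    rw [nhds_prod_eq, ((𝓝 x₀).basis_sets.prod Metric.nhds_basis_ball).eventually_iff] at hslit
    obtain ⟨⟨N, δ⟩, ⟨hN, hδ⟩, hND⟩ := hslit
    simp only [id] at hN hδ hND
    have hx₀ : x₀ ∈ N := mem_of_mem_nhds hN
    have hND' : ∀ x ∈ N, ∀ ζ ∈ Metric.ball y δ,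
        (x, ζ) ∈ E ∧ f (x, ζ) / f (x₀, y) ∈ Complex.slitPlane := fun x hx ζ hζ => hND ⟨hx, hζ⟩
    refine ⟨δ, hδ, fun ζ hζ => (hND' x₀ hx₀ ζ hζ).1, fun y₁ hy₁ hc y₂ hy₂ => ?_⟩
    set Λ : X × ℂ → ℂ := fun p => Complex.log (f p / f (x₀, y)) with hΛ
    have hΛc : ∀ x ∈ N, ∀ ζ ∈ Metric.ball y δ, ContinuousAt Λ (x, ζ) := by
      intro x hx ζ hζ
      obtain ⟨h1, h2⟩ := hND' x hx ζ hζ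
      exact ((hf.continuousAt (hE.mem_nhds h1)).div_const _).clog h2
    have hΛe : ∀ x ∈ N, ∀ ζ ∈ Metric.ball y δ,
        Complex.exp (ℓ (x, ζ) - Λ (x, ζ)) = f (x₀, y) := by
      intro x hx ζ hζ
      obtain ⟨h1, h2⟩ := hND' x hx ζ hζ
      have h3 := Complex.slitPlane_ne_zero h2
      have h4 : f (x, ζ) ≠ 0 := fun h => h3 (by rw [h, zero_div])
      rw [Complex.exp_sub, hexp _ h1, hΛ, Complex.exp_log h3]
      field_simp
    -- On each small disc the fibrewise logarithm differs from the jointly continuous `Λ` by a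
    -- constant, which can be read off at any point `y₁`. Continuity in `x` at one point of the disc
    -- therefore gives joint continuity throughout.
    have heq : ∀ x ∈ N, ∀ ζ ∈ Metric.ball y δ,
        ℓ (x, ζ) = Λ (x, ζ) + (ℓ (x, y₁) - Λ (x, y₁)) := by
      intro x hx ζ hζ
      have := (convex_ball y δ).isPreconnected.sub_eq_of_exp_eq
        (g₁ := fun ζ => ℓ (x, ζ)) (g₂ := fun ζ => Λ (x, ζ))
        ((hfib x).mono fun ζ hζ => (hND' x hx ζ hζ).1)
        (fun ζ hζ => ((hΛc x hx ζ hζ).comp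
          (Continuous.prodMk_right x).continuousAt).continuousWithinAt)
        (fun ζ hζ ζ' hζ' => by rw [hΛe x hx ζ hζ, hΛe x hx ζ' hζ']) hζ hy₁
      linear_combination this
    have hev : ∀ᶠ p in 𝓝 (x₀, y₂), ℓ p = Λ p + (ℓ (p.1, y₁) - Λ (p.1, y₁)) := by
      have : N ×ˢ Metric.ball y δ ∈ 𝓝 (x₀, y₂) :=
        prod_mem_nhds hN (Metric.isOpen_ball.mem_nhds hy₂)
      filter_upwards [this] with p hp using heq p.1 hp.1 p.2 hp.2
    refine ContinuousAt.congr ?_ (hev.mono fun p hp => hp.symm)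
    have hfst : ContinuousAt (Prod.fst : X × ℂ → X) (x₀, y₂) := continuousAt_fst
    refine (hΛc x₀ hx₀ y₂ hy₂).add (ContinuousAt.sub ?_ ?_)
    · exact ContinuousAt.comp (f := Prod.fst) (x := (x₀, y₂)) hc hfst
    · have h1 : ContinuousAt (fun x => Λ (x, y₁)) x₀ :=
        (hΛc x₀ hx₀ y₁ hy₁).comp (f := fun x => (x, y₁)) (Continuous.prodMk_left y₁).continuousAt
      exact ContinuousAt.comp (f := Prod.fst) (x := (x₀, y₂)) h1 hfst
  have hrestr : ∀ y, ContinuousAt ℓ (x₀, y) → ContinuousAt (fun x => ℓ (x, y)) x₀ := fun y h =>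
    h.comp (f := fun x => (x, y)) (Continuous.prodMk_left y).continuousAt
  -- Continuity in `x` spreads from disc to disc along the preconnected fibre.
  have hall : ContinuousAt (fun x => ℓ (x, a)) x₀ ↔ ContinuousAt (fun x => ℓ (x, y)) x₀ := by
    refine hpre.induction₂' (fun y y' => ContinuousAt (fun x => ℓ (x, y)) x₀ ↔
      ContinuousAt (fun x => ℓ (x, y')) x₀) ?_ (fun _ _ _ _ _ _ h h' => h.trans h') ha hy
    intro y hy
    obtain ⟨δ, hδ, -, hb⟩ := key y hy
    filter_upwards [nhdsWithin_le_nhds (Metric.ball_mem_nhds y hδ)] with z hz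
    have hyb := Metric.mem_ball_self hδ (x := y)
    have : ContinuousAt (fun x => ℓ (x, y)) x₀ ↔ ContinuousAt (fun x => ℓ (x, z)) x₀ :=
      ⟨fun h => hrestr _ (hb y hyb h z hz), fun h => hrestr _ (hb z hz h y hyb)⟩
    exact ⟨this, this.symm⟩
  obtain ⟨δ, hδ, -, hb⟩ := key y hy
  exact hb y (Metric.mem_ball_self hδ) (hall.1 hca) y (Metric.mem_ball_self hδ)

/-- A continuous function that is constant on the fibres of an open set descends to the base. -/
theorem exists_continuousOn_descend {X Y Z : Type*} [TopologicalSpace X] [TopologicalSpace Y]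
    [TopologicalSpace Z] [Nonempty Z] {E : Set (X × Y)} (hE : IsOpen E) {h : X × Y → Z}
    (hh : ContinuousOn h E)
    (hconst : ∀ x y y', (x, y) ∈ E → (x, y') ∈ E → h (x, y) = h (x, y')) :
    ∃ g : X → Z, ContinuousOn g (Prod.fst '' E) ∧ ∀ x y, (x, y) ∈ E → g x = h (x, y) := by
  classical
  set g : X → Z := fun x => if hx : ∃ y, (x, y) ∈ E then h (x, hx.choose) else
    Classical.arbitrary Z with hg
  have hgh : ∀ x y, (x, y) ∈ E → g x = h (x, y) := by
    intro x y hxy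
    have hx : ∃ y, (x, y) ∈ E := ⟨y, hxy⟩
    simp only [hg, dif_pos hx]
    exact hconst _ _ _ hx.choose_spec hxy
  refine ⟨g, ?_, hgh⟩
  rintro _ ⟨⟨x, y⟩, hxy, rfl⟩
  have hc : ContinuousAt (fun x' => (x', y)) x := (Continuous.prodMk_left y).continuousAt
  have hmem : ∀ᶠ x' in 𝓝 x, (x', y) ∈ E := hc.eventually_mem (hE.mem_nhds hxy)
  have h1 : ContinuousAt (fun x' => h (x', y)) x :=
    ContinuousAt.comp (f := fun x' => (x', y)) (hh.continuousAt (hE.mem_nhds hxy)) hc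
  exact (h1.congr (hmem.mono fun x' hx' => (hgh x' y hx').symm)).continuousWithinAt

/-- Fibrewise continuous logarithms with a prescribed value at one point. -/
theorem HasContinuousLogs.exists_eq_at {X : Type*} [TopologicalSpace X] {U : Set X}
    (hU : HasContinuousLogs U) {f : X → ℂ} (hf : ContinuousOn f U) (h0 : ∀ x ∈ U, f x ≠ 0)
    {a : X} (ha : a ∈ U) {b : ℂ} (hb : Complex.exp b = f a) :
    ∃ g : X → ℂ, ContinuousOn g U ∧ (∀ x ∈ U, Complex.exp (g x) = f x) ∧ g a = b := by
  obtain ⟨g, hg, he⟩ := hU f hf h0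
  refine ⟨fun x => g x + (b - g a), hg.add continuousOn_const, fun x hx => ?_, by ring⟩
  rw [Complex.exp_add, Complex.exp_sub, he x hx, hb, he a ha, div_self (h0 a ha), mul_one]

/-- If all fibres of an open set over a base have continuous logarithms, and so does the base,
then the whole set has continuous logarithms. -/
theorem hasContinuousLogs_of_fibres {X : Type*} [TopologicalSpace X] [NormalSpace X]
    [ParacompactSpace X] (hX : HasContinuousLogs (univ : Set X)) {E : Set (X × ℂ)} (hE : IsOpen E)
    (hne : ∀ x, {ζ | (x, ζ) ∈ E}.Nonempty) (hpre : ∀ x, IsPreconnected {ζ | (x, ζ) ∈ E})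
    (hlog : ∀ x, HasContinuousLogs {ζ | (x, ζ) ∈ E}) : HasContinuousLogs E := by
  intro f hf hf0
  choose a ha using hne
  have hfibc : ∀ x, ContinuousOn (fun ζ => f (x, ζ)) {ζ | (x, ζ) ∈ E} := fun x =>
    hf.comp (Continuous.prodMk_right x).continuousOn fun ζ hζ => hζ
  have hloc : ∀ i : X, ∃ N : Set X, IsOpen N ∧ i ∈ N ∧ ∃ ℓ : X × ℂ → ℂ,
      (∀ p ∈ E, p.1 ∈ N → ContinuousAt ℓ p) ∧ ∀ p ∈ E, Complex.exp (ℓ p) = f p := by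
    intro i
    have hc : ContinuousAt (fun x => (x, a i)) i := (Continuous.prodMk_left _).continuousAt
    have hfi : ContinuousAt (fun x => f (x, a i)) i :=
      ContinuousAt.comp (f := fun x => (x, a i)) (hf.continuousAt (hE.mem_nhds (ha i))) hc
    have hev : ∀ᶠ x in 𝓝 i, (x, a i) ∈ E ∧ f (x, a i) / f (i, a i) ∈ Complex.slitPlane := by
      refine (hc.eventually_mem (hE.mem_nhds (ha i))).and
        ((hfi.div_const _).eventually_mem (Complex.isOpen_slitPlane.mem_nhds ?_))
      rw [div_self (hf0 _ (ha i))]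
      exact Complex.one_mem_slitPlane
    obtain ⟨N, hN, hNo, hiN⟩ := mem_nhds_iff.1 hev
    -- Over `N` the fibrewise branches are normalised to vary continuously along the constant
    -- section `a i`; off `N` any branch will do.
    have hbr : ∀ x, ∃ g : ℂ → ℂ, ContinuousOn g {ζ | (x, ζ) ∈ E} ∧
        (∀ ζ ∈ {ζ | (x, ζ) ∈ E}, Complex.exp (g ζ) = f (x, ζ)) ∧
        (x ∈ N → g (a i) = Complex.log (f (x, a i) / f (i, a i)) + Complex.log (f (i, a i))) := by
      intro x
      by_cases hx : x ∈ N
      · obtain ⟨h1, h2⟩ := hN hx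
        obtain ⟨g, hg, hge, hga⟩ := (hlog x).exists_eq_at (hfibc x) (fun ζ hζ => hf0 _ hζ) h1
          (b := Complex.log (f (x, a i) / f (i, a i)) + Complex.log (f (i, a i))) (by
            rw [Complex.exp_add, Complex.exp_log (Complex.slitPlane_ne_zero h2),
              Complex.exp_log (hf0 _ (ha i)), div_mul_cancel₀ _ (hf0 _ (ha i))])
        exact ⟨g, hg, hge, fun _ => hga⟩
      · obtain ⟨g, hg, hge⟩ := hlog x _ (hfibc x) fun ζ hζ => hf0 _ hζ
        exact ⟨g, hg, hge, fun h => absurd h hx⟩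
    choose g hg hge hga using hbr
    refine ⟨N, hNo, hiN, fun p => g p.1 p.2, ?_, fun p hp => hge _ _ hp⟩
    rintro ⟨x, ζ⟩ hp hxN
    refine continuousAt_fibrewise_log hE hf (ℓ := fun p => g p.1 p.2) (fun p hp => hge _ _ hp) hg
      (hpre x) (hN hxN).1 ?_ hp
    have hcx : ContinuousAt (fun x => f (x, a i)) x :=
      ContinuousAt.comp (f := fun x => (x, a i)) (hf.continuousAt (hE.mem_nhds (hN hxN).1))
        (Continuous.prodMk_left _).continuousAt
    refine ContinuousAt.congr (((hcx.div_const (f (i, a i))).clog (hN hxN).2).add_const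
      (Complex.log (f (i, a i)))) ?_
    filter_upwards [hNo.mem_nhds hxN] with x' hx' using (hga x' hx').symm
  choose N hNo hiN ℓ hℓc hℓe using hloc
  obtain ⟨ρ, hρ⟩ := PartitionOfUnity.exists_isSubordinate isClosed_univ N hNo
    fun x _ => mem_iUnion.2 ⟨x, hiN x⟩
  have hfin : ∀ p : X × ℂ, (Function.support fun i => ρ i p.1 • ℓ i p).Finite := fun p =>
    (ρ.locallyFinite.point_finite p.1).subset fun i hi => (left_ne_zero_of_smul hi)
  set h : X × ℂ → ℂ := fun p => ∑ᶠ i, ρ i p.1 • ℓ i p with hh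
  have hcont : ContinuousOn h E := by
    have hc : Continuous fun z : E => ∑ᶠ i, ρ i z.1.1 • ℓ i z.1 := by
      have hfst : Continuous fun z : E => z.1.1 := by fun_prop
      refine continuous_finsum (fun i => continuous_iff_continuousAt.2 fun z => ?_)
        ((ρ.locallyFinite.preimage_continuous hfst).subset fun i z hz =>
          left_ne_zero_of_smul hz)
      by_cases hz : z.1.1 ∈ tsupport (ρ i)
      · refine ContinuousAt.smul ((ρ i).continuous.comp hfst).continuousAt ?_
        exact ContinuousAt.comp (f := fun z : E => z.1) (hℓc i _ z.2 (hρ i hz))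
          continuous_subtype_val.continuousAt
      · have hev : ∀ᶠ z' : E in 𝓝 z, ρ i z'.1.1 • ℓ i z'.1 = 0 := by
          have := hfst.continuousAt.eventually_mem
            ((isClosed_tsupport (ρ i)).isOpen_compl.mem_nhds hz)
          filter_upwards [this] with z' hz'
          rw [image_eq_zero_of_notMem_tsupport hz', zero_smul]
        exact continuousAt_const.congr (hev.mono fun z' hz' => hz'.symm)
    exact continuousOn_iff_continuous_domRestrict.2 hc
  -- On one fibre the local logarithms differ by constants, so their convex combination `h` is
  -- itself a logarithm of `f` up to a constant. The error `exp h / f` descends to the base, where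
  -- its logarithm is then subtracted.
  have hhexp : ∀ x ζ ζ', (x, ζ) ∈ E → (x, ζ') ∈ E →
      Complex.exp (h (x, ζ)) / f (x, ζ) = Complex.exp (h (x, ζ')) / f (x, ζ') := by
    intro x ζ ζ' hζ hζ'
    have hdiff : ∀ i, x ∈ N i → ℓ i (x, ζ) - ℓ i (x, ζ') = ℓ x (x, ζ) - ℓ x (x, ζ') := by
      intro i hi
      have hc : ∀ j, x ∈ N j → ContinuousOn (fun ζ => ℓ j (x, ζ)) {ζ | (x, ζ) ∈ E} :=
        fun j hj ζ hζ => (ContinuousAt.comp (f := fun ζ => (x, ζ)) (hℓc j _ hζ hj)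
          (Continuous.prodMk_right x).continuousAt).continuousWithinAt
      have hone : ∀ ζ ∈ {ζ | (x, ζ) ∈ E}, Complex.exp (ℓ i (x, ζ) - ℓ x (x, ζ)) = 1 :=
        fun ζ hζ => by
          rw [Complex.exp_sub, hℓe i _ hζ, hℓe x _ hζ, div_self (hf0 _ hζ)]
      have := (hpre x).sub_eq_of_exp_eq (hc i hi) (hc x (hiN x))
        (fun ζ hζ ζ' hζ' => by rw [hone ζ hζ, hone ζ' hζ']) hζ hζ'
      linear_combination this
    have hsub : h (x, ζ) - h (x, ζ') = ℓ x (x, ζ) - ℓ x (x, ζ') := by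
      rw [hh]
      simp only
      rw [← finsum_sub_distrib (hfin (x, ζ)) (hfin (x, ζ'))]
      have : ∀ i, ρ i x • ℓ i (x, ζ) - ρ i x • ℓ i (x, ζ') =
          ρ i x • (ℓ x (x, ζ) - ℓ x (x, ζ')) := by
        intro i
        rw [← smul_sub]
        by_cases hi : ρ i x = 0
        · rw [hi, zero_smul, zero_smul]
        · rw [hdiff i (hρ i (subset_tsupport _ hi))]
      simp only [this]
      rw [← finsum_smul, ρ.sum_eq_one (mem_univ x), one_smul]
    have hE1 := congrArg Complex.exp hsub
    rw [Complex.exp_sub, Complex.exp_sub, hℓe _ _ hζ, hℓe _ _ hζ'] at hE1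
    have h1 := hf0 _ hζ
    have h2 := hf0 _ hζ'
    have h3 := Complex.exp_ne_zero (h (x, ζ'))
    field_simp at hE1 ⊢
    linear_combination hE1
  obtain ⟨c, hc, hce⟩ := exists_continuousOn_descend hE
    (h := fun p => Complex.exp (h p) / f p) (hcont.cexp.div hf hf0) hhexp
  have himg : Prod.fst '' E = univ := by
    ext x
    simpa using ⟨a x, ha x⟩
  rw [himg] at hc
  obtain ⟨k, hk, hke⟩ := hX c hc fun x _ => by
    rw [hce x (a x) (ha x)]
    exact div_ne_zero (Complex.exp_ne_zero _) (hf0 _ (ha x))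
  refine ⟨fun p => h p - k p.1, hcont.sub (hk.comp continuousOn_fst fun _ _ => mem_univ _), ?_⟩
  rintro ⟨x, ζ⟩ hp
  rw [Complex.exp_sub, hke x (mem_univ _), hce x ζ hp, div_div_cancel₀ (Complex.exp_ne_zero _)]

/-! ### Projections and linear convexity of `ℂ`-convex sets. -/

/-- All intersections with complex lines are preconnected and have continuous logarithms. -/
def IsWeaklyCConvex {V : Type*} [AddCommGroup V] [Module ℂ V] (U : Set V) : Prop :=
  ∀ a v : V, IsPreconnected {ζ : ℂ | a + ζ • v ∈ U} ∧ HasContinuousLogs {ζ : ℂ | a + ζ • v ∈ U}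

/-- The weak form also admits `v = 0` and empty sections, so it passes to preimages under affine
maps, even non-injective ones. -/
theorem IsCConvex.isWeaklyCConvex {n : ℕ} {Ω : Set (EuclideanSpace ℂ (Fin n))} (hΩ : IsOpen Ω)
    (h : IsCConvex Ω) : IsWeaklyCConvex Ω := by
  intro a v
  rcases eq_empty_or_nonempty {ζ : ℂ | a + ζ • v ∈ Ω} with he | hne
  · rw [he]
    exact ⟨isPreconnected_empty, (convex_empty (𝕜 := ℝ)).hasContinuousLogs isOpen_empty⟩
  by_cases hv : v = 0
  · have he : {ζ : ℂ | a + ζ • v ∈ Ω} = univ := by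
      obtain ⟨ζ, hζ⟩ := hne
      ext ζ'
      simpa [hv] using hζ
    rw [he]
    exact ⟨isPreconnected_univ, (convex_univ (𝕜 := ℝ)).hasContinuousLogs isOpen_univ⟩
  · have hs := h a v hv hne
    have ho : IsOpen {ζ : ℂ | a + ζ • v ∈ Ω} :=
      hΩ.preimage (f := fun ζ : ℂ => a + ζ • v) (by fun_prop)
    exact ⟨hs.isPathConnected.isConnected.isPreconnected, hs.hasContinuousLogs ho⟩

section Projection

variable {V : Type*} [NormedAddCommGroup V] [NormedSpace ℂ V] {U : Set V}

theorem IsWeaklyCConvex.isPreconnected (h : IsWeaklyCConvex U) : IsPreconnected U := by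
  refine isPreconnected_of_forall_pair fun x hx y hy => ?_
  refine ⟨(fun ζ : ℂ => x + ζ • (y - x)) '' {ζ : ℂ | x + ζ • (y - x) ∈ U}, ?_, ⟨0, ?_, ?_⟩,
    ⟨1, ?_, ?_⟩, (h x (y - x)).1.image _ (by fun_prop)⟩
  · rintro _ ⟨ζ, hζ, rfl⟩
    exact hζ
  all_goals simp [hx, hy]

/-- Logarithms are chosen on each line through a base point `q`, all with the same value at `q`.
They are jointly continuous in direction and parameter, and their values at parameter `1` give the
logarithm on `U`. -/
theorem IsWeaklyCConvex.hasContinuousLogs (h : IsWeaklyCConvex U) (hU : IsOpen U) :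
    HasContinuousLogs U := by
  intro f hf hf0
  rcases U.eq_empty_or_nonempty with rfl | ⟨q, hq⟩
  · exact ⟨0, continuousOn_empty _, by simp⟩
  have hmap : Continuous fun p : V × ℂ => q + p.2 • p.1 := by fun_prop
  set E : Set (V × ℂ) := {p | q + p.2 • p.1 ∈ U} with hE
  have hEo : IsOpen E := hU.preimage hmap
  set F : V × ℂ → ℂ := fun p => f (q + p.2 • p.1) with hF
  have hFc : ContinuousOn F E := hf.comp hmap.continuousOn fun p hp => hp
  have h0 : ∀ v : V, (0 : ℂ) ∈ {ζ : ℂ | (v, ζ) ∈ E} := fun v => by simpa [hE] using hq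
  have hbr : ∀ v : V, ∃ g : ℂ → ℂ, ContinuousOn g {ζ | (v, ζ) ∈ E} ∧
      (∀ ζ ∈ {ζ | (v, ζ) ∈ E}, Complex.exp (g ζ) = F (v, ζ)) ∧ g 0 = Complex.log (f q) :=
    fun v => (h q v).2.exists_eq_at
      (hFc.comp (Continuous.prodMk_right v).continuousOn fun ζ hζ => hζ)
      (fun ζ hζ => hf0 _ hζ) (h0 v) (by simp [hF, Complex.exp_log (hf0 q hq)])
  choose g hg hge hg0 using hbr
  refine ⟨fun z => g (z - q) 1, fun z hz => ContinuousAt.continuousWithinAt ?_, fun z hz => ?_⟩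
  · have hz1 : (z - q, (1 : ℂ)) ∈ E := by simpa [hE] using hz
    have := continuousAt_fibrewise_log hEo hFc (ℓ := fun p => g p.1 p.2)
      (fun p hp => hge _ _ hp) hg (h q (z - q)).1 (h0 (z - q)) (by simpa [hg0] using
        continuousAt_const) hz1
    exact ContinuousAt.comp (f := fun z => (z - q, (1 : ℂ))) this (by fun_prop)
  · have := hge (z - q) 1 (by simpa [hE] using hz)
    simpa [hF] using this

/-- Projections of `ℂ`-convex sets to the line have continuous logarithms. -/
theorem IsWeaklyCConvex.hasContinuousLogs_image_fst {W : Type*} [NormedAddCommGroup W]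
    [NormedSpace ℂ W] {U : Set (ℂ × W)} (h : IsWeaklyCConvex U) (hU : IsOpen U) :
    HasContinuousLogs (Prod.fst '' U) := by
  intro f hf hf0
  -- The pullback of `f` is constant on the fibres of the projection, and two points of a fibre are
  -- joined inside a preconnected line section; hence its logarithm descends.
  obtain ⟨g, hg, hge⟩ := h.hasContinuousLogs hU (fun p => f p.1)
    (hf.comp continuousOn_fst fun p hp => ⟨p, hp, rfl⟩) fun p hp => hf0 _ ⟨p, hp, rfl⟩
  obtain ⟨k, hk, hke⟩ := exists_continuousOn_descend hU hg (by
    intro ζ m m' hm hm'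
    have hS := (h (ζ, m) ((0 : ℂ), m' - m)).1
    set S : Set ℂ := {t : ℂ | (ζ, m) + t • ((0 : ℂ), m' - m) ∈ U} with hSdef
    have h0 : (0 : ℂ) ∈ S := by simpa [hSdef] using hm
    have h1 : (1 : ℂ) ∈ S := by simpa [hSdef] using hm'
    have hc : ContinuousOn (fun t : ℂ => g ((ζ, m) + t • ((0 : ℂ), m' - m))) S :=
      hg.comp (by fun_prop) fun t ht => ht
    have := hS.sub_eq_of_exp_eq hc (continuousOn_const (c := (0 : ℂ))) (fun s hs t ht => by
      rw [sub_zero, sub_zero, hge _ hs, hge _ ht]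
      simp) h0 h1
    simpa using this)
  refine ⟨k, hk, ?_⟩
  rintro _ ⟨⟨ζ, m⟩, hp, rfl⟩
  rw [hke ζ m hp]
  exact hge _ hp

theorem isOpen_setOf_exists_mem_submodule (hU : IsOpen U) (M : Submodule ℂ V) {Y : Type*}
    [TopologicalSpace Y] {φ : Y → V} (hφ : Continuous φ) :
    IsOpen {y | ∃ m ∈ M, φ y + m ∈ U} := by
  have : {y | ∃ m ∈ M, φ y + m ∈ U} = ⋃ m ∈ M, (fun y => φ y + m) ⁻¹' U := by
    ext y
    simp
  rw [this]
  exact isOpen_biUnion fun m _ => hU.preimage (by fun_prop)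

theorem IsWeaklyCConvex.projection (h : IsWeaklyCConvex U) (hU : IsOpen U) (M : Submodule ℂ V)
    (p v : V) : IsPreconnected {ζ : ℂ | ∃ m ∈ M, p + ζ • v + m ∈ U} ∧
      HasContinuousLogs {ζ : ℂ | ∃ m ∈ M, p + ζ • v + m ∈ U} := by
  set E : Set (ℂ × M) := {q | p + q.1 • v + (q.2 : V) ∈ U} with hE
  have hEo : IsOpen E := hU.preimage (f := fun q : ℂ × M => p + q.1 • v + (q.2 : V)) (by fun_prop)
  have hEw : IsWeaklyCConvex E := by
    rintro ⟨ζ, m⟩ ⟨η, m'⟩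
    have : {t : ℂ | (ζ, m) + t • (η, m') ∈ E} =
        {t : ℂ | (p + ζ • v + (m : V)) + t • (η • v + (m' : V)) ∈ U} := by
      ext t
      simp only [hE, mem_ofPred_eq, Prod.smul_mk, Prod.mk_add_mk, smul_eq_mul, Submodule.coe_add,
        Submodule.coe_smul]
      rw [show p + (ζ + t * η) • v + ((m : V) + t • (m' : V)) =
        p + ζ • v + (m : V) + t • (η • v + (m' : V)) by module]
    rw [this]
    exact h _ _
  have himg : {ζ : ℂ | ∃ m ∈ M, p + ζ • v + m ∈ U} = Prod.fst '' E := by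
    ext ζ
    simp [hE]
  rw [himg]
  exact ⟨hEw.isPreconnected.image _ continuousOn_fst, hEw.hasContinuousLogs_image_fst hEo⟩

end Projection

/-- There is no continuous logarithm on the punctured plane. -/
theorem not_continuousOn_log_compl_zero (k : ℂ → ℂ) (hk : ContinuousOn k {0}ᶜ) :
    ¬ ∀ z : ℂ, z ≠ 0 → Complex.exp (k z) = z := by
  intro h
  have hc : ContinuousOn (fun θ : ℝ => k (circleMap 0 1 θ)) univ :=
    hk.comp (continuous_circleMap 0 1).continuousOn fun θ _ => circleMap_ne_center one_ne_zero
  have hc' : ContinuousOn (fun θ : ℝ => (θ * Complex.I : ℂ)) univ := by fun_prop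
  have key : ∀ θ : ℝ, Complex.exp (k (circleMap 0 1 θ) - θ * Complex.I) = 1 := by
    intro θ
    rw [Complex.exp_sub, h _ (circleMap_ne_center one_ne_zero)]
    simp [circleMap]
  -- Along the unit circle the logarithm would be `iθ` plus a constant, yet it takes equal values at
  -- `0` and `2π`.
  have := isPreconnected_univ.sub_eq_of_exp_eq hc hc'
    (fun x _ y _ => by rw [key x, key y]) (mem_univ 0) (mem_univ (2 * Real.pi))
  have e : circleMap 0 1 (2 * Real.pi) = circleMap 0 1 0 := by simp [circleMap]
  rw [e] at this
  have h2 : (2 * Real.pi * Complex.I : ℂ) = 0 := by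
    push_cast at this
    linear_combination this
  exact Complex.two_pi_I_ne_zero h2

/-- A `ℂ`-convex open set in `ℂ²` that omits the origin is disjoint from some line through the
origin. -/
theorem not_forall_line_nonempty {U : Set (ℂ × ℂ)} (hU : IsOpen U) (h0 : (0, 0) ∉ U)
    (h : ∀ a b : ℂ, (a, b) ≠ (0, 0) → {ζ : ℂ | (ζ * a, ζ * b) ∈ U}.Nonempty ∧
      IsPreconnected {ζ : ℂ | (ζ * a, ζ * b) ∈ U} ∧
      HasContinuousLogs {ζ : ℂ | (ζ * a, ζ * b) ∈ U}) : False := by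
  have hC : HasContinuousLogs (univ : Set ℂ) :=
    (convex_univ (𝕜 := ℝ)).hasContinuousLogs isOpen_univ
  -- The lines through the origin form a projective line. Over each of its two affine charts, `(1,
  -- t)` and `(s, 1)`, the fibre coordinate is nonzero on `U` and acquires a continuous logarithm.
  have hchart : ∀ (A : ℂ → ℂ) (B : ℂ → ℂ), Continuous A → Continuous B →
      (∀ t, (A t, B t) ≠ (0, 0)) → ∃ L : ℂ × ℂ → ℂ,
      ContinuousOn L {p | (p.2 * A p.1, p.2 * B p.1) ∈ U} ∧
      ∀ p ∈ {p : ℂ × ℂ | (p.2 * A p.1, p.2 * B p.1) ∈ U}, Complex.exp (L p) = p.2 := by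
    intro A B hA hB hAB
    have hEo : IsOpen {p : ℂ × ℂ | (p.2 * A p.1, p.2 * B p.1) ∈ U} :=
      hU.preimage (f := fun p : ℂ × ℂ => (p.2 * A p.1, p.2 * B p.1)) (by fun_prop)
    refine hasContinuousLogs_of_fibres hC hEo (fun t => (h _ _ (hAB t)).1)
      (fun t => (h _ _ (hAB t)).2.1) (fun t => (h _ _ (hAB t)).2.2) (fun p => p.2)
      continuousOn_snd ?_
    intro p hp hp0
    apply h0
    simpa [hp0] using hp
  obtain ⟨L₁, hL₁, he₁⟩ := hchart (fun _ => 1) (fun t => t) (by fun_prop) (by fun_prop) (by simp)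
  obtain ⟨L₂, hL₂, he₂⟩ := hchart (fun s => s) (fun _ => 1) (by fun_prop) (by fun_prop) (by simp)
  set E : Set (ℂ × ℂ) := {p | p.1 ≠ 0 ∧ (p.2 * 1, p.2 * p.1) ∈ U} with hE
  have hEo : IsOpen E :=
    (isOpen_ne_fun continuous_fst continuous_const).inter
      (hU.preimage (f := fun p : ℂ × ℂ => (p.2 * 1, p.2 * p.1)) (by fun_prop))
  have hE2 : ∀ p ∈ E, (p.1⁻¹, p.1 * p.2) ∈ {p : ℂ × ℂ | (p.2 * p.1, p.2 * 1) ∈ U} := by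
    rintro ⟨t, a⟩ ⟨ht, hp⟩
    have ht : t ≠ 0 := ht
    have e : (t * a * t⁻¹, t * a * 1) = (a * 1, a * t) := by
      ext
      · simp only
        field_simp
      · simp only
        ring
    change (t * a * t⁻¹, t * a * 1) ∈ U
    rw [e]
    exact hp
  -- On the overlap `s = 1/t` the fibre coordinates are `a` and `ta`, so the difference of the
  -- logarithms is a logarithm of `t`. Being constant on the fibres, it descends to the punctured
  -- plane, which is impossible.
  set q : ℂ × ℂ → ℂ := fun p => L₂ (p.1⁻¹, p.1 * p.2) - L₁ p with hq
  have hqc : ContinuousOn q E := by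
    refine ContinuousOn.sub (hL₂.comp ?_ hE2) (hL₁.mono fun p hp => hp.2)
    exact (continuousOn_fst.inv₀ fun p hp => hp.1).prodMk (by fun_prop)
  have hqe : ∀ p ∈ E, Complex.exp (q p) = p.1 := by
    intro p hp
    have hp2 : p.2 ≠ 0 := by
      intro h2
      apply h0
      simpa [h2] using hp.2
    rw [hq, Complex.exp_sub, he₁ p hp.2, he₂ _ (hE2 p hp)]
    field_simp
  obtain ⟨k, hk, hke⟩ := exists_continuousOn_descend hEo hqc (by
    intro t a a' ha ha'
    have hpre := (h 1 t (by simp)).2.1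
    have hc : ContinuousOn (fun a => q (t, a)) {ζ : ℂ | (ζ * 1, ζ * t) ∈ U} :=
      hqc.comp (Continuous.prodMk_right t).continuousOn fun a hx => ⟨ha.1, hx⟩
    have := hpre.sub_eq_of_exp_eq hc (continuousOn_const (c := (0 : ℂ))) (fun x hx y hy => by
      rw [sub_zero, sub_zero, hqe (t, x) ⟨ha.1, hx⟩, hqe (t, y) ⟨ha.1, hy⟩]) ha.2 ha'.2
    simpa using this)
  have hne : ∀ t : ℂ, t ≠ 0 → ∃ a, (t, a) ∈ E := fun t ht => by
    obtain ⟨a, ha⟩ := (h 1 t (by simp)).1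
    exact ⟨a, ht, ha⟩
  refine not_continuousOn_log_compl_zero k (hk.mono fun t ht => ?_) fun t ht => ?_
  · obtain ⟨a, ha⟩ := hne t ht
    exact ⟨(t, a), ha, rfl⟩
  · obtain ⟨a, ha⟩ := hne t ht
    rw [hke t a ha, hqe _ ha]

/-- Linear convexity of `ℂ`-convex open sets: a point outside lies on a complex hyperplane
`{ξ (z - w) = 1}` that omits the set, and the projection along it has continuous logarithms. -/
theorem IsWeaklyCConvex.exists_hyperplane {V : Type*} [NormedAddCommGroup V] [NormedSpace ℂ V]
    [FiniteDimensional ℂ V] {U : Set V} (h : IsWeaklyCConvex U) (hU : IsOpen U) {w p : V}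
    (hw : w ∈ U) (hp : p ∉ U) :
    ∃ (ξ : V →L[ℂ] ℂ) (D : Set ℂ), IsOpen D ∧ HasContinuousLogs D ∧ (1 : ℂ) ∉ D ∧
      (∀ z ∈ U, ξ (z - w) ∈ D) ∧ ξ (p - w) = 1 := by
  -- A minimum for `>` is a maximal subspace whose translate through `p` misses `U`.
  obtain ⟨M, hM, hmax⟩ := (wellFounded_gt (α := Submodule ℂ V)).has_min
    {M | ∀ m ∈ M, p + m ∉ U} ⟨⊥, by simpa using hp⟩
  have hM : ∀ m ∈ M, p + m ∉ U := hM
  set v := w - p with hv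
  have hvM : v ∉ M := fun hvm => hM v hvm (by simpa [hv] using hw)
  -- Otherwise `v` and `y` are independent modulo `M`. The projection of `U` to their plane omits
  -- the origin, while by maximality of `M` every line through the origin meets it, contradicting
  -- `not_forall_line_nonempty`.
  have htop : ∀ y, y ∈ M ⊔ Submodule.span ℂ {v} := by
    intro y
    by_contra hy
    refine not_forall_line_nonempty (U := {q : ℂ × ℂ | ∃ m ∈ M, (p + q.1 • v + q.2 • y) + m ∈ U})
      (isOpen_setOf_exists_mem_submodule hU M (by fun_prop)) ?_ fun a b hab => ?_
    · rintro ⟨m, hm, hmU⟩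
      exact hM m hm (by simpa using hmU)
    · have hset : {ζ : ℂ | (ζ * a, ζ * b) ∈ {q : ℂ × ℂ | ∃ m ∈ M, (p + q.1 • v + q.2 • y) + m ∈ U}} =
          {ζ : ℂ | ∃ m ∈ M, p + ζ • (a • v + b • y) + m ∈ U} := by
        ext ζ
        simp only [mem_ofPred_eq]
        rw [show p + (ζ * a) • v + (ζ * b) • y = p + ζ • (a • v + b • y) by module]
      rw [hset]
      refine ⟨?_, h.projection hU M p _⟩
      have hu : a • v + b • y ∉ M := by
        intro hu
        by_cases hb : b = 0
        · have ha : a ≠ 0 := fun ha => hab (by rw [ha, hb])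
          rw [hb, zero_smul, add_zero] at hu
          exact hvM ((Submodule.smul_mem_iff M ha).1 hu)
        · apply hy
          have hby : b • y ∈ M ⊔ Submodule.span ℂ {v} := by
            have := Submodule.sub_mem _ (Submodule.mem_sup_left (T := Submodule.span ℂ {v}) hu)
              (Submodule.mem_sup_right (S := M)
                (Submodule.smul_mem _ a (Submodule.mem_span_singleton_self v)))
            simpa using this
          exact (Submodule.smul_mem_iff _ hb).1 hby
      have hlt : M < M ⊔ Submodule.span ℂ {a • v + b • y} := by
        refine lt_of_le_of_ne le_sup_left fun he => hu ?_
        rw [he]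
        exact Submodule.mem_sup_right (Submodule.mem_span_singleton_self _)
      obtain ⟨x, hx, hxU⟩ : ∃ x ∈ M ⊔ Submodule.span ℂ {a • v + b • y}, p + x ∈ U := by
        by_contra! hcon
        exact hmax _ hcon hlt
      obtain ⟨m, hm, s, hs, rfl⟩ := Submodule.mem_sup.1 hx
      obtain ⟨c, rfl⟩ := Submodule.mem_span_singleton.1 hs
      exact ⟨c, m, hm, by rwa [add_assoc, add_comm (c • _)]⟩
  obtain ⟨f, hfv, hfM⟩ := M.exists_dual_map_eq_bot_of_notMem hvM inferInstance
  have hfM : ∀ m ∈ M, f m = 0 := fun m hm => by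
    have : f m ∈ M.map f := Submodule.mem_map_of_mem hm
    rw [hfM] at this
    simpa using this
  -- The sign makes `ξ (p - w) = 1`, since `v = w - p`.
  set ξ : V →L[ℂ] ℂ := LinearMap.toContinuousLinearMap (-(f v)⁻¹ • f) with hξ
  have hξa : ∀ x, ξ x = -(f v)⁻¹ * f x := fun x => rfl
  have hξv : ξ v = -1 := by
    rw [hξa, neg_mul, inv_mul_cancel₀ hfv]
  have hξM : ∀ m ∈ M, ξ m = 0 := fun m hm => by rw [hξa, hfM m hm, mul_zero]
  refine ⟨ξ, {ζ : ℂ | ∃ m ∈ M, w + ζ • (-v) + m ∈ U},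
    isOpen_setOf_exists_mem_submodule hU M (by fun_prop), (h.projection hU M w (-v)).2, ?_, ?_, ?_⟩
  · rintro ⟨m, hm, hmU⟩
    refine hM m hm ?_
    convert hmU using 2
    rw [hv]
    module
  · intro z hz
    obtain ⟨m, hm, s, hs, hms⟩ := Submodule.mem_sup.1 (htop (z - w))
    obtain ⟨c, rfl⟩ := Submodule.mem_span_singleton.1 hs
    refine ⟨m, hm, ?_⟩
    have e : ξ (z - w) = -c := by
      rw [← hms, map_add, hξM m hm, map_smul, hξv]
      simp
    rw [e]
    convert hz using 1
    rw [smul_neg, neg_smul, neg_neg, add_assoc, add_comm (c • v), hms]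
    abel
  · rw [show p - w = -v by rw [hv]; abel, map_neg, hξv, neg_neg]

/-! ### The `ℂ`-convex case and the conclusion. -/

/-- Koebe's theorem on the projection gives derivatives at least `r / 4` for every `r < 1`, and `|ξ
X| ≥ 4` restores the factor. -/
theorem quarter_smul_mem_balancedPart_of_isCConvex {Ω : Set (EuclideanSpace ℂ (Fin n))}
    {w : EuclideanSpace ℂ (Fin n)} (hΩ : IsOpen Ω) (hconv : IsCConvex Ω) (hw : w ∈ Ω)
    {X : EuclideanSpace ℂ (Fin n)} (hX : X ∈ azukawaIndicatrix Ω w) :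
    (4 : ℝ)⁻¹ • X ∈ balancedPart Ω w := by
  intro η hη
  by_contra hn
  obtain ⟨ξ, D, hD, hlog, h1D, hmap, hξ⟩ :=
    (hconv.isWeaklyCConvex hΩ).exists_hyperplane hΩ hw hn
  rw [add_sub_cancel_left] at hξ
  have hle := norm_clm_ge_of_re_eq_one ξ hη four_pos (by rw [hξ, Complex.one_re])
  have h0D : (0 : ℂ) ∈ D := by simpa using hmap w hw
  refine notMem_azukawaIndicatrix_of_clm (X := X) hΩ hw ξ hD hmap (fun r hr0 hr1 => ?_) hX
  obtain ⟨ψ, hψ, hr⟩ := exists_mapsTo_ball_deriv_ge hD hlog h0D h1D hr0 hr1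
  refine ⟨ψ, hψ.differentiableOn, fun z hz => by simpa using hψ.mapsTo hz, hψ.map_zero, ?_⟩
  calc r = r / 4 * 4 := by ring
    _ ≤ _ := by gcongr

theorem theorem5 (n : ℕ) (Ω : Set (EuclideanSpace ℂ (Fin n))) (w : EuclideanSpace ℂ (Fin n))
    (hopen : IsOpen Ω) (hconn : IsConnected Ω) (hw : w ∈ Ω) :
    (IsCConvex Ω →
      bergmanKernel Ω w ≤ (16 : ℝ≥0∞) ^ n / volume (azukawaIndicatrix Ω w)) ∧
    (Convex ℝ Ω →
      bergmanKernel Ω w ≤ (4 : ℝ≥0∞) ^ n / volume (azukawaIndicatrix Ω w)) ∧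
    (Convex ℝ Ω → (∀ v : EuclideanSpace ℂ (Fin n), w + v ∈ Ω → w - v ∈ Ω) →
      bergmanKernel Ω w ≤
        ENNReal.ofReal (16 / Real.pi ^ 2) ^ n / volume (azukawaIndicatrix Ω w)) := by
  refine ⟨fun h => ?_, fun h => ?_, fun h hs => ?_⟩
  · have := bergmanKernel_le_of_subset hopen four_pos fun X hX =>
      quarter_smul_mem_balancedPart_of_isCConvex hopen h hw hX
    norm_num at this
    exact this
  · have := bergmanKernel_le_of_subset hopen two_pos fun X hX =>
      half_smul_mem_balancedPart_of_convex hopen h hw hX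
    norm_num at this
    exact this
  · have := bergmanKernel_le_of_subset hopen (div_pos four_pos Real.pi_pos) fun X hX =>
      pi_div_four_smul_mem_balancedPart_of_symmetric hopen h hw hs hX
    rw [div_pow] at this
    norm_num at this ⊢
    exact this
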